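/- Let $\mathcal R=\{z\in\mathbf C:\operatorname{Re}z>0\}$ and $\Delta=\{\zeta\in\mathbf C:|\zeta-1|<1\}$. For $0<b<\infty$ let $S_b=\{z: 0<\operatorname{Re}z<b\}$, and let $H^2(S_b)$ be the space of holomorphic functions $f$ on $S_b$ with $\sup_{0<x<b}\int_{-\infty}^{+\infty}|f(x+iy)|^2\,dy<\infty$. Let $\mathcal M^2_\omega(\mathcal R)$ be the space of all holomorphic functions $f$ on $\mathcal R$ such that $f\in H^2(S_b)$ for every $0<b<\infty$ and $$\sum_{n=0}^{+\infty}\frac{2^n}{n!}\int_{-\infty}^{+\infty}\big|f\big(\tfrac n2+iy\big)\big|^2\,dy<\infty,$$ where, in the term $n=0$, $f(i\,\cdot)$ denotes the boundary value of $f$, i.e. the limit of $f(x+i\,\cdot)$ in $L^2(\mathbf R)$ as $x\to0^+$. Let $A^2(\Delta)$ be the Bergman space of holomorphic functions on $\Delta$ that are square integrable with respect to Lebesgue measure. **Theorem.** Let $\{z_j\}$ be a sequence of points in $\mathcal R$ such that $\operatorname{Re}z_j\ge\varepsilon_0$ for all $j$, for some $\varepsilon_0>0$, and such that $$\limsup_{R\to+\infty}\frac1{\log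 R}\sum_{|z_j|\le R}\operatorname{Re}\Big(\frac1{z_j}\Big)>\frac2\pi,$$ where the sum runs over the distinct points of the set $\{z_j\}$ (and may be $+\infty$). Then $\{z_j\}$ is a set of uniqueness for $\mathcal M^2_\omega(\mathcal R)$, that is, every $f\in\mathcal M^2_\omega(\mathcal R)$ with $f(z_j)=0$ for all $j$ is identically $0$. Consequently, for such a sequence, the set of powers $\{\zeta^{z_j-1}\}$ (principal branch) is complete in $A^2(\Delta)$, that is, these functions belong to $A^2(\Delta)$ and their linear span is dense in $A^2(\Delta)$. -/

import Mathlib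

open Filter Topology MeasureTheory
open scoped ENNReal

noncomputable section

namespace MuntzSzasz

/-- The open right half-plane. -/
def rightHalfPlane : Set ℂ := {z | 0 < z.re}

/-- The vertical strip of points with real part strictly between `0` and `b`. -/
def strip (b : ℝ) : Set ℂ := {z | 0 < z.re ∧ z.re < b}

/-- Membership in the Hardy space `H²` of the strip of width `b`. -/
def MemHardyStrip (b : ℝ) (f : ℂ → ℂ) : Prop :=
  DifferentiableOn ℂ f (strip b) ∧
    (⨆ x ∈ Set.Ioo (0 : ℝ) b, ∫⁻ y : ℝ, ‖f ⟨x, y⟩‖ₑ ^ 2) < ∞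

/-- The measure `∑ₙ (2ⁿ / n!) δ_{n/2}(x) ⊗ dy`; it is carried by the closed right half-plane. -/
def omega : Measure ℂ :=
  Measure.sum fun n : ℕ =>
    ENNReal.ofReal (2 ^ n / (n.factorial : ℝ)) •
      Measure.map (fun y : ℝ => (⟨(n : ℝ) / 2, y⟩ : ℂ)) volume

/-- `g` is the boundary value of `f` on the imaginary axis: the `L²(ℝ)` limit of
`f(x + i·)` as `x → 0⁺`. -/
def IsBoundaryValue (f : ℂ → ℂ) (g : ℝ → ℂ) : Prop :=
  MemLp g 2 volume ∧
    Tendsto (fun x : ℝ => eLpNorm (fun y : ℝ => f ⟨x, y⟩ - g y) 2 volume) (𝓝[>] 0) (𝓝 0)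

/-- The function equal to `f` on the right half-plane and given by `g` on the imaginary axis
(values at points with negative real part are irrelevant). -/
def withBoundary (f : ℂ → ℂ) (g : ℝ → ℂ) (z : ℂ) : ℂ :=
  if 0 < z.re then f z else g z.im

/-- Membership in `M²_ω` of the right half-plane. Only the values of `f` on the open right
half-plane matter; on the imaginary axis `f` is understood as its `L²` boundary value. -/
def MemM2 (f : ℂ → ℂ) : Prop :=
  DifferentiableOn ℂ f rightHalfPlane ∧
    (∀ b : ℝ, 0 < b → MemHardyStrip b f) ∧
    ∃ g : ℝ → ℂ, IsBoundaryValue f g ∧ MemLp (withBoundary f g) 2 omega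

/-- `Z` is a set of uniqueness for `M²_ω` of the right half-plane. -/
def IsUniquenessSet (Z : Set ℂ) : Prop :=
  ∀ f : ℂ → ℂ, MemM2 f → (∀ w ∈ Z, f w = 0) → ∀ z ∈ rightHalfPlane, f z = 0

/-- The sum of `Re (1/w)` over the points `w` of `Z` with `|w| ≤ R`, possibly infinite; it is
used for `Z` in the right half-plane, where all the terms are positive. -/
def carlemanSum (Z : Set ℂ) (R : ℝ) : ℝ≥0∞ :=
  ∑' w : {w : ℂ // w ∈ Z ∧ ‖w‖ ≤ R}, ENNReal.ofReal (1 / (w : ℂ)).re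

/-- The Carleman-type condition
`limsup_{R → ∞} (1 / log R) ∑_{w ∈ Z, |w| ≤ R} Re (1/w) ≤ 2/π`. -/
def CarlemanCondition (Z : Set ℂ) : Prop :=
  limsup (fun R : ℝ => carlemanSum Z R / ENNReal.ofReal (Real.log R)) atTop
    ≤ ENNReal.ofReal (2 / Real.pi)

/-- The disk `|ζ - 1| < 1`. -/
def diskDelta : Set ℂ := Metric.ball 1 1

/-- Membership in the (unweighted) Bergman space `A²` of the disk `|ζ - 1| < 1`. -/
def MemBergman (f : ℂ → ℂ) : Prop :=
  DifferentiableOn ℂ f diskDelta ∧ MemLp f 2 (volume.restrict diskDelta)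

/-- `S` is a complete set in the Bergman space: it consists of functions of the space, and its
linear span is dense there. -/
def IsCompleteInBergman (S : Set (ℂ → ℂ)) : Prop :=
  (∀ p ∈ S, MemBergman p) ∧
    ∀ f : ℂ → ℂ, MemBergman f → ∀ ε : ℝ≥0∞, 0 < ε →
      ∃ p ∈ Submodule.span ℂ S, eLpNorm (f - p) 2 (volume.restrict diskDelta) < ε

end MuntzSzasz

end

noncomputable section

namespace MuntzSzasz

/-! Both claims follow from one uniqueness principle for the growth class `HasGrowth`, where `|f z|
≤ exp((1 + Re z)(log(1 + |z|) + C))` on each `Re z ≥ δ`. Divide such an `f`, shifted to be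
holomorphic across the imaginary axis, by the Blaschke product of its zeros in `|w| ≤ R`, and apply
the maximum principle on a half disc of radius `K R`. At a fixed large real point `x₀`, with `f`
nonzero there, each distant zero gains about `2 x₀ Re (1/w)`, while growth allows only about `x₀ log
R`. So `∑ Re (1/w)` is at most roughly `(1/2) log R`. Explicit losses raise `1/2` to `3/5`, still
below `2/π` (`norm_le_blaschke_mul_exp`, `exists_sum_re_one_div_le`, `eq_zero_of_hasGrowth`).

A function of `M²_ω` lies in this class: its square means on the lines `Re z = n/2` are `O(n!)`, the
three lines theorem interpolates between these lines, and the area mean value inequality yields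
pointwise bounds (`MemM2.hasGrowth`).

For completeness, let `h` in `L²` be orthogonal to the given powers. The pairing of `h` with
`ζ^(z-1)`, times `exp((z+1) log(z+1))`, lies in the same class, so it vanishes identically. At `z =
n + 1` this says that `h` is orthogonal to all monomials, hence to the Bergman space
(`integral_conj_mul_eq_zero_of_memBergman`), and Hilbert space duality concludes. -/

/-! ### Blaschke factors of the half-plane and the maximum principle on half discs. -/

/-- A holomorphic function vanishing on a finite set is divisible by the polynomial with
simple zeros there. -/
theorem exists_eq_prod_sub_mul {U : Set ℂ} (hU : IsOpen U) (W : Finset ℂ) :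
    ∀ {f : ℂ → ℂ}, DifferentiableOn ℂ f U → (∀ w ∈ W, w ∈ U) → (∀ w ∈ W, f w = 0) →
      ∃ h : ℂ → ℂ, DifferentiableOn ℂ h U ∧ ∀ z ∈ U, f z = (∏ w ∈ W, (z - w)) * h z := by
  classical
  induction W using Finset.induction_on with
  | empty => intro f hf _ _; exact ⟨f, hf, by simp⟩
  | insert a W ha ih =>
    intro f hf hWU hW
    obtain ⟨h, hh, hfh⟩ := ih hf (fun w hw => hWU w (Finset.mem_insert_of_mem hw))
      (fun w hw => hW w (Finset.mem_insert_of_mem hw))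
    have haU : a ∈ U := hWU a (Finset.mem_insert_self a W)
    have hha : h a = 0 := by
      have h1 := hfh a haU
      rw [hW a (Finset.mem_insert_self a W)] at h1
      refine (mul_eq_zero.1 h1.symm).resolve_left (Finset.prod_ne_zero_iff.2 fun w hw => ?_)
      exact sub_ne_zero.2 (fun h => ha (h ▸ hw))
    refine ⟨dslope h a, (Complex.differentiableOn_dslope (hU.mem_nhds haU)).2 hh, fun z hz => ?_⟩
    have h2 : (z - a) * dslope h a z = h z := by
      have := sub_smul_dslope h a z
      rw [hha, sub_zero] at this
      simpa using this
    rw [Finset.prod_insert ha, hfh z hz, ← h2]; ring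

/-- Controls the modulus of the Blaschke factor `(z - w)/(z + conj w)`: it is `1` on the imaginary
axis and less than `1` inside. -/
theorem normSq_add_conj_eq (z w : ℂ) :
    ‖z + (starRingEnd ℂ) w‖ ^ 2 = ‖z - w‖ ^ 2 + 4 * z.re * w.re := by
  rw [Complex.sq_norm, Complex.sq_norm, Complex.normSq_apply, Complex.normSq_apply]
  simp; ring

/-- From `1 + t ≤ exp t`. It shows that a Blaschke factor is close to `1` far from its zero, and
serves on the arc of the half disc. -/
theorem norm_add_conj_le_mul_exp {z w : ℂ} {d : ℝ} (hd : 0 < d) (hzw : d ≤ ‖z - w‖)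
    (hz : 0 ≤ z.re) (hw : 0 ≤ w.re) :
    ‖z + (starRingEnd ℂ) w‖ ≤ ‖z - w‖ * Real.exp (2 * z.re * w.re / d ^ 2) := by
  have h0 : 0 < ‖z - w‖ := hd.trans_le hzw
  refine le_of_sq_le_sq ?_ (by positivity)
  rw [normSq_add_conj_eq, mul_pow, ← Real.exp_nat_mul]
  have h1 : 4 * z.re * w.re / d ^ 2 + 1 ≤ Real.exp ((2 : ℕ) * (2 * z.re * w.re / d ^ 2)) := by
    refine le_trans (le_of_eq ?_) (Real.add_one_le_exp _)
    push_cast; ring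
  have h2 : 4 * z.re * w.re ≤ ‖z - w‖ ^ 2 * (4 * z.re * w.re / d ^ 2) := by
    rw [mul_div_assoc', le_div_iff₀ (by positivity), mul_comm]
    have : d ^ 2 ≤ ‖z - w‖ ^ 2 := by gcongr
    gcongr
  nlinarith [sq_nonneg ‖z - w‖, mul_le_mul_of_nonneg_left h1 (sq_nonneg ‖z - w‖)]

/-- From `1 - t ≤ exp (-t)`. This is the gain contributed by each zero at the interior point. -/
theorem norm_sub_le_mul_exp {z w : ℂ} (hz : 0 < z.re) (hw : 0 < w.re) :
    ‖z - w‖ ≤ ‖z + (starRingEnd ℂ) w‖ *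
      Real.exp (-(2 * z.re * w.re / ‖z + (starRingEnd ℂ) w‖ ^ 2)) := by
  have h0 : 0 < ‖z + (starRingEnd ℂ) w‖ := by
    refine norm_pos_iff.2 fun h => ?_
    have := congrArg Complex.re h
    simp at this; linarith
  set N := ‖z + (starRingEnd ℂ) w‖ with hN
  refine le_of_sq_le_sq ?_ (by positivity)
  have h3 := normSq_add_conj_eq z w
  rw [mul_pow, ← Real.exp_nat_mul]
  have h1 : 1 - 4 * z.re * w.re / N ^ 2 ≤ Real.exp ((2 : ℕ) * -(2 * z.re * w.re / N ^ 2)) := by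
    refine le_trans (le_of_eq ?_) (Real.add_one_le_exp _)
    push_cast; ring
  have h2 : N ^ 2 * (1 - 4 * z.re * w.re / N ^ 2) = N ^ 2 - 4 * z.re * w.re := by
    field_simp
  have := mul_le_mul_of_nonneg_left h1 (sq_nonneg N)
  linarith

theorem re_one_div (w : ℂ) : (1 / w).re = w.re / ‖w‖ ^ 2 := by
  rw [one_div, Complex.inv_re, Complex.normSq_eq_norm_sq]

/-- The maximum principle on a half disc, applied after division by a finite Blaschke product
of the half-plane. -/
theorem norm_le_blaschke_mul_exp {h : ℂ → ℂ} {δ D A R K : ℝ} (hδ : 0 < δ) (hR : 0 < R)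
    (hK : 1 < K) (hh : DifferentiableOn ℂ h {z | -δ < z.re}) (W : Finset ℂ)
    (hW0 : ∀ w ∈ W, h w = 0) (hWre : ∀ w ∈ W, 0 < w.re) (hWR : ∀ w ∈ W, ‖w‖ ≤ R)
    (hgrowth : ∀ z : ℂ, 0 ≤ z.re → ‖z‖ ≤ K * R → ‖h z‖ ≤ Real.exp ((D + z.re) * A))
    {z₀ : ℂ} (hz₀ : 0 < z₀.re) (hz₀R : ‖z₀‖ < K * R) :
    ‖h z₀‖ ≤ Real.exp ((D + z₀.re) * A +
      2 * z₀.re / (K - 1) ^ 2 * ∑ w ∈ W, (1 / w).re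
      - ∑ w ∈ W, 2 * z₀.re * w.re / ‖z₀ + (starRingEnd ℂ) w‖ ^ 2) := by
  set S := ∑ w ∈ W, (1 / w).re with hS
  set c : ℝ := 2 / (K - 1) ^ 2 with hc
  have hopen : IsOpen {z : ℂ | -δ < z.re} := isOpen_lt continuous_const Complex.continuous_re
  obtain ⟨q, hq, hfq⟩ := exists_eq_prod_sub_mul hopen W hh
    (fun w hw => by have := hWre w hw; simp; linarith) hW0
  set V : Set ℂ := {z | 0 < z.re} ∩ Metric.ball 0 (K * R) with hV
  -- `P` is `h` over the Blaschke product, times the inverse of the growth majorant. The extra term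
  -- `c * S * z` makes up for the Blaschke product being smaller than `1` on the arc.
  set P : ℂ → ℂ := fun z => q z * (∏ w ∈ W, (z + (starRingEnd ℂ) w)) *
    Complex.exp (-((D + z) * A + c * S * z)) with hP
  have hclV : closure V ⊆ {z : ℂ | 0 ≤ z.re} ∩ Metric.closedBall 0 (K * R) := by
    refine closure_minimal ?_ ?_
    · rintro z ⟨h1, h2⟩
      exact ⟨show (0 : ℝ) ≤ z.re from le_of_lt h1, Metric.ball_subset_closedBall h2⟩
    · exact (isClosed_le continuous_const Complex.continuous_re).inter Metric.isClosed_closedBall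
  have hVopen : IsOpen V := (isOpen_lt continuous_const Complex.continuous_re).inter
    Metric.isOpen_ball
  have hPd : DifferentiableOn ℂ P {z | -δ < z.re} := by
    refine (hq.mul ?_).mul ?_
    · fun_prop
    · fun_prop
  have hPnorm : ∀ z, ‖P z‖ = ‖q z‖ * (∏ w ∈ W, ‖z + (starRingEnd ℂ) w‖) *
      Real.exp (-((D + z.re) * A + c * S * z.re)) := by
    intro z
    simp only [hP, norm_mul, norm_prod, Complex.norm_exp]
    congr 2
    simp [Complex.mul_re]
  have hhnorm : ∀ z : ℂ, -δ < z.re → ‖h z‖ = (∏ w ∈ W, ‖z - w‖) * ‖q z‖ := by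
    intro z hz
    rw [hfq z hz, norm_mul, norm_prod]
  have hfront : ∀ z ∈ frontier V, ‖P z‖ ≤ 1 := by
    intro z hz
    have hzcl := hclV (frontier_subset_closure hz)
    have hznot : z ∉ V := by
      rw [hVopen.frontier_eq] at hz; exact hz.2
    have hre : 0 ≤ z.re := hzcl.1
    have hnorm : ‖z‖ ≤ K * R := by simpa using hzcl.2
    have key : (∏ w ∈ W, ‖z + (starRingEnd ℂ) w‖) ≤
        (∏ w ∈ W, ‖z - w‖) * Real.exp (c * S * z.re) := by
      have : Real.exp (c * S * z.re) = ∏ w ∈ W, Real.exp (c * (1 / w).re * z.re) := by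
        rw [← Real.exp_sum, hS, Finset.mul_sum, Finset.sum_mul]
      rw [this, ← Finset.prod_mul_distrib]
      refine Finset.prod_le_prod (fun _ _ => norm_nonneg _) fun w hw => ?_
      have hwre := hWre w hw
      have hw0 : 0 < ‖w‖ := norm_pos_iff.2 fun h => by simp [h] at hwre
      rcases hre.eq_or_lt with h0 | hpos
      · have := normSq_add_conj_eq z w
        rw [← h0] at this
        rw [← h0, mul_zero, Real.exp_zero, mul_one]
        refine le_of_sq_le_sq ?_ (norm_nonneg _)
        linarith
      · have hzn : ‖z‖ = K * R := by
          refine le_antisymm hnorm (not_lt.1 fun hlt => hznot ⟨hpos, ?_⟩)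
          simpa using hlt
        -- On the arc the distance to a zero is at least `(K - 1) R`, and `R⁻² ≤ ‖w‖⁻²` turns the
        -- resulting exponent into a multiple of `Re (1/w)`.
        have hd : (K - 1) * R ≤ ‖z - w‖ := by
          have := norm_sub_norm_le z w
          have := hWR w hw
          linarith
        refine (norm_add_conj_le_mul_exp (mul_pos (by linarith) hR) hd hre hwre.le).trans ?_
        gcongr
        rw [re_one_div, hc, div_mul_div_comm, div_mul_eq_mul_div]
        have hK1 : 0 < K - 1 := by linarith
        have hwR := hWR w hw
        rw [mul_pow]
        rw [show 2 * w.re * z.re = 2 * z.re * w.re by ring]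
        gcongr
    rw [hPnorm, neg_add, Real.exp_add, Real.exp_neg (c * S * z.re)]
    have h3 := hgrowth z hre hnorm
    rw [hhnorm z (by linarith)] at h3
    calc ‖q z‖ * (∏ w ∈ W, ‖z + (starRingEnd ℂ) w‖) *
          (Real.exp (-((D + z.re) * A)) * (Real.exp (c * S * z.re))⁻¹)
        ≤ ‖q z‖ * ((∏ w ∈ W, ‖z - w‖) * Real.exp (c * S * z.re)) *
          (Real.exp (-((D + z.re) * A)) * (Real.exp (c * S * z.re))⁻¹) := by gcongr
      _ = ((∏ w ∈ W, ‖z - w‖) * ‖q z‖) * Real.exp (-((D + z.re) * A)) := by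
          have := (Real.exp_pos (c * S * z.re)).ne'
          field_simp
      _ ≤ Real.exp ((D + z.re) * A) * Real.exp (-((D + z.re) * A)) := by gcongr
      _ = 1 := by rw [← Real.exp_add]; simp
  have hsub : closure V ⊆ {z : ℂ | -δ < z.re} := fun z hz => by
    have h1 : 0 ≤ z.re := (hclV hz).1
    show -δ < z.re
    linarith
  have hz₀V : z₀ ∈ closure V := subset_closure ⟨hz₀, by simpa using hz₀R⟩
  have hmax := Complex.norm_le_of_forall_mem_frontier_norm_le
    (Metric.isBounded_ball.subset (Set.inter_subset_right : V ⊆ _))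
    ((hPd.mono hsub).diffContOnCl) hfront hz₀V
  rw [hPnorm] at hmax
  rw [hhnorm z₀ (by linarith)]
  have hprod : ∏ w ∈ W, ‖z₀ - w‖ ≤ (∏ w ∈ W, ‖z₀ + (starRingEnd ℂ) w‖) *
      Real.exp (-∑ w ∈ W, 2 * z₀.re * w.re / ‖z₀ + (starRingEnd ℂ) w‖ ^ 2) := by
    rw [← Finset.sum_neg_distrib, Real.exp_sum, ← Finset.prod_mul_distrib]
    exact Finset.prod_le_prod (fun _ _ => norm_nonneg _) fun w hw =>
      norm_sub_le_mul_exp hz₀ (hWre w hw)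
  set E := ∑ w ∈ W, 2 * z₀.re * w.re / ‖z₀ + (starRingEnd ℂ) w‖ ^ 2
  set Q := ∏ w ∈ W, ‖z₀ + (starRingEnd ℂ) w‖
  have h4 : ‖q z₀‖ * Q ≤ Real.exp ((D + z₀.re) * A + c * S * z₀.re) := by
    rw [Real.exp_neg] at hmax
    have := Real.exp_pos ((D + z₀.re) * A + c * S * z₀.re)
    rwa [← div_eq_mul_inv, div_le_one this] at hmax
  calc (∏ w ∈ W, ‖z₀ - w‖) * ‖q z₀‖ ≤ (Q * Real.exp (-E)) * ‖q z₀‖ := by gcongr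
    _ = (‖q z₀‖ * Q) * Real.exp (-E) := by ring
    _ ≤ Real.exp ((D + z₀.re) * A + c * S * z₀.re) * Real.exp (-E) := by gcongr
    _ = _ := by
      rw [← Real.exp_add]; congr 1
      rw [hc]; ring

/-! ### Density of the zeros under the growth condition. -/

/-- The growth condition `log |f z| ≤ (1 + Re z) (log (1 + |z|) + C)` on every closed half-plane
inside the right half-plane. -/
def HasGrowth (f : ℂ → ℂ) : Prop :=
  ∀ δ : ℝ, 0 < δ → ∃ C : ℝ, ∀ z : ℂ, δ ≤ z.re →
    ‖f z‖ ≤ Real.exp ((1 + z.re) * (Real.log (1 + ‖z‖) + C))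

theorem isOpen_rightHalfPlane : IsOpen rightHalfPlane :=
  isOpen_lt continuous_const Complex.continuous_re

theorem isPreconnected_rightHalfPlane : IsPreconnected rightHalfPlane :=
  (convex_halfSpace_re_gt 0).isPreconnected

theorem eqOn_zero_of_accPt {f : ℂ → ℂ} (hf : DifferentiableOn ℂ f rightHalfPlane) {p : ℂ}
    (hp : p ∈ rightHalfPlane) {Z : Set ℂ} (hZ : ∀ w ∈ Z, f w = 0) (hacc : AccPt p (𝓟 Z)) :
    ∀ z ∈ rightHalfPlane, f z = 0 := by
  refine fun z hz => (hf.analyticOnNhd isOpen_rightHalfPlane).eqOn_zero_of_preconnected_of_frequently_eq_zero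
    isPreconnected_rightHalfPlane hp ?_ hz
  exact (accPt_iff_frequently_nhdsNE.1 hacc).mono hZ

/-- The bound `ε₀ ≤ Re w` keeps accumulation points of the zeros off the imaginary axis. -/
theorem finite_zeros_of_ne_zero {f : ℂ → ℂ} (hf : DifferentiableOn ℂ f rightHalfPlane)
    {Z : Set ℂ} {ε₀ : ℝ} (hε₀ : 0 < ε₀) (hZre : ∀ w ∈ Z, ε₀ ≤ w.re) (hZ : ∀ w ∈ Z, f w = 0)
    (hne : ¬ ∀ z ∈ rightHalfPlane, f z = 0) (R : ℝ) : {w | w ∈ Z ∧ ‖w‖ ≤ R}.Finite := by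
  by_contra hinf
  have hcomp : IsCompact (Metric.closedBall (0 : ℂ) R ∩ {w | ε₀ ≤ w.re}) :=
    (isCompact_closedBall 0 R).inter_right (isClosed_le continuous_const Complex.continuous_re)
  obtain ⟨p, hp, hacc⟩ := Set.Infinite.exists_accPt_of_subset_isCompact hinf hcomp
    (fun w hw => ⟨by simpa using hw.2, hZre w hw.1⟩)
  exact hne (eqOn_zero_of_accPt hf (hε₀.trans_le hp.2) (fun w hw => hZ w hw.1) hacc)

theorem exists_real_ne_zero {f : ℂ → ℂ} (hf : DifferentiableOn ℂ f rightHalfPlane)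
    (hne : ¬ ∀ z ∈ rightHalfPlane, f z = 0) {X : ℝ} (hX : 0 < X) :
    ∃ x : ℝ, X ≤ x ∧ f x ≠ 0 := by
  by_contra! hcon
  refine hne (eqOn_zero_of_accPt hf (p := (X : ℂ)) (Z := (fun x : ℝ => (x : ℂ)) '' Set.Ici X)
    (by simpa [rightHalfPlane] using hX) ?_ ?_)
  · rintro _ ⟨x, hx, rfl⟩; exact hcon x hx
  · have h1 : AccPt X (𝓟 (Set.Ici X)) := by
      rw [accPt_iff_frequently_nhdsNE]
      have : ∀ᶠ y in 𝓝[>] X, y ∈ Set.Ici X :=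
        eventually_nhdsWithin_of_forall fun y hy => (Set.mem_Ioi.1 hy).le
      exact this.frequently.filter_mono (nhdsWithin_mono _ fun y hy => ne_of_gt hy)
    rw [accPt_iff_frequently] at h1 ⊢
    rw [show (X : ℂ) = (fun x : ℝ => (x : ℂ)) X from rfl]
    refine (Complex.continuous_ofReal.tendsto X).frequently (h1.mono ?_)
    rintro y ⟨h1, h2⟩
    exact ⟨fun h => h1 (Complex.ofReal_injective h), y, h2, rfl⟩

theorem re_one_div_nonneg {w : ℂ} (hw : 0 ≤ w.re) : 0 ≤ (1 / w).re := by
  rw [re_one_div]; positivity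

/-- Moving the zeros left by `δ`, the price of holomorphy across the imaginary axis, costs at most a
factor `9/10` in the sum. -/
theorem re_one_div_sub_le {w : ℂ} {δ : ℝ} (hδ : 0 < δ) (hw : 10 * δ ≤ w.re) :
    9 / 10 * (1 / w).re ≤ (1 / (w - δ)).re ∧ ‖w - δ‖ ≤ ‖w‖ := by
  have h1 : ‖w - δ‖ ^ 2 ≤ ‖w‖ ^ 2 := by
    rw [Complex.sq_norm, Complex.sq_norm, Complex.normSq_apply, Complex.normSq_apply]
    simp; nlinarith
  refine ⟨?_, le_of_sq_le_sq h1 (norm_nonneg _)⟩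
  have h0 : 0 < ‖w - δ‖ := norm_pos_iff.2 fun h => by
    have := congrArg Complex.re h
    simp at this; linarith
  rw [re_one_div, re_one_div, mul_div_assoc']
  have : 9 / 10 * w.re ≤ (w - δ).re := by simp; linarith
  have h2 : 0 ≤ (w - (δ : ℂ)).re := by linarith
  gcongr

/-- If `‖w‖ ≥ 100 x` then `‖x + conj w‖ ≤ 1.01 ‖w‖`, and `1.01⁻² > 98/100`. For closer zeros the
left side is nonpositive. -/
theorem blaschke_exponent_ge {w : ℂ} {x L : ℝ} (hx : 0 < x) (hw : 0 < w.re) (hL : L = 100 * x) :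
    2 * x * (98 / 100 * (1 / w).re - if ‖w‖ < L then (1 / w).re else 0) ≤
      2 * x * w.re / ‖(x : ℂ) + (starRingEnd ℂ) w‖ ^ 2 := by
  have h0 := re_one_div_nonneg hw.le
  split_ifs with h
  · refine le_trans (mul_nonpos_of_nonneg_of_nonpos (by positivity) (by linarith)) (by positivity)
  · rw [sub_zero, mul_div_assoc]
    refine mul_le_mul_of_nonneg_left ?_ (by positivity)
    rw [re_one_div]
    have hw0 : 0 < ‖w‖ := norm_pos_iff.2 fun h => by simp [h] at hw
    have h1 : ‖(x : ℂ) + (starRingEnd ℂ) w‖ ≤ 101 / 100 * ‖w‖ := by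
      refine (norm_add_le _ _).trans ?_
      rw [Complex.norm_real, Real.norm_of_nonneg hx.le, RCLike.norm_conj]
      linarith [not_lt.1 h]
    have h2 : 0 < ‖(x : ℂ) + (starRingEnd ℂ) w‖ := norm_pos_iff.2 fun h => by
      have := congrArg Complex.re h
      simp at this; linarith
    rw [mul_div_assoc', div_le_div_iff₀ (by positivity) (by positivity)]
    have h3 : ‖(x : ℂ) + (starRingEnd ℂ) w‖ ^ 2 ≤ (101 / 100 * ‖w‖) ^ 2 := by gcongr
    nlinarith [mul_le_mul_of_nonneg_left h3 hw.le, mul_nonneg hw.le (sq_nonneg ‖w‖)]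

/-- The density of the zeros of a nonzero function of the given growth is at most `3/5`. -/
theorem exists_sum_re_one_div_le {f : ℂ → ℂ} (hf : DifferentiableOn ℂ f rightHalfPlane)
    (hg : HasGrowth f) {Z : Set ℂ} {ε₀ : ℝ} (hε₀ : 0 < ε₀) (hZre : ∀ w ∈ Z, ε₀ ≤ w.re)
    (hZ : ∀ w ∈ Z, f w = 0) (hne : ¬ ∀ z ∈ rightHalfPlane, f z = 0)
    (hfin : ∀ R : ℝ, {w | w ∈ Z ∧ ‖w‖ ≤ R}.Finite) :
    ∃ C : ℝ, ∀ᶠ R : ℝ in atTop,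
      ∑ w ∈ (hfin R).toFinset, (1 / w).re ≤ 3 / 5 * Real.log R + C := by
  classical
  set δ : ℝ := ε₀ / 10 with hδdef
  have hδ : 0 < δ := by positivity
  obtain ⟨C₀, hC₀⟩ := hg δ hδ
  set h : ℂ → ℂ := fun z => f (z + δ) with hh
  -- The base point is taken so far out that `1 + δ + x₀ ≤ 1.01 x₀`.
  obtain ⟨x₁, hx₁, hfx₁⟩ := exists_real_ne_zero hf hne (X := 100 * (1 + δ) + δ) (by positivity)
  set x₀ : ℝ := x₁ - δ with hx₀def
  have hx₀ : 100 * (1 + δ) ≤ x₀ := by linarith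
  have hx₀pos : 0 < x₀ := by linarith
  have hhx₀ : h x₀ ≠ 0 := by simpa [hh, hx₀def] using hfx₁
  have hhd : DifferentiableOn ℂ h {z | -δ < z.re} := by
    refine hf.comp (by fun_prop) fun z hz => ?_
    have hz' : -δ < z.re := hz
    simp [rightHalfPlane]; linarith
  set L : ℝ := 100 * x₀ with hL
  -- Contribution of the zeros close to `x₀`; it does not depend on `R`.
  set CL : ℝ := ∑ w ∈ (hfin (L + δ)).toFinset, (1 / (w - δ)).re with hCL
  -- For `‖z‖ ≤ 11 R` and `R ≥ 1`, `1 + ‖z + δ‖ ≤ (12 + δ) R`.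
  set c₁ : ℝ := Real.log (12 + δ) + |C₀| with hc₁
  -- Here `505/1000 = 1.01/2` and `873/1000 = (9/10)(98/100 - 1/100)`, where `1/100 = 1/(K - 1)²`
  -- for `K = 11`. The density obtained is `505/873 < 3/5`.
  set C : ℝ := (CL + 505 / 1000 * c₁ + |Real.log ‖h x₀‖| / (2 * x₀)) / (873 / 1000) with hC
  refine ⟨C, ?_⟩
  filter_upwards [eventually_ge_atTop 1, eventually_ge_atTop x₀] with R hR hRx₀
  have hmem : ∀ {R w}, w ∈ (hfin R).toFinset ↔ w ∈ Z ∧ ‖w‖ ≤ R := by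
    intro R w; simp
  have hre : ∀ {R w}, w ∈ (hfin R).toFinset → 10 * δ ≤ w.re := fun hw => by
    have := hZre _ (hmem.1 hw).1
    rw [hδdef]; linarith
  have hlogR : 0 ≤ Real.log R := Real.log_nonneg hR
  set A : ℝ := Real.log R + c₁ with hA
  have hA0 : 0 ≤ A := by
    have : 0 ≤ Real.log (12 + δ) := Real.log_nonneg (by linarith)
    positivity
  have hinj : Function.Injective fun w : ℂ => w - δ := sub_left_injective
  have hgrowth : ∀ z : ℂ, 0 ≤ z.re → ‖z‖ ≤ 11 * R →
      ‖h z‖ ≤ Real.exp ((1 + δ + z.re) * A) := by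
    intro z hz hzR
    refine (hC₀ (z + δ) (by simpa using hz)).trans ?_
    rw [Real.exp_le_exp]
    have e1 : 1 + (z + (δ : ℂ)).re = 1 + δ + z.re := by simp; ring
    rw [e1]
    refine mul_le_mul_of_nonneg_left ?_ (by positivity)
    have h2 : ‖z + (δ : ℂ)‖ ≤ ‖z‖ + δ := by
      refine (norm_add_le _ _).trans ?_
      rw [Complex.norm_real, Real.norm_of_nonneg hδ.le]
    have h3 : Real.log (1 + ‖z + (δ : ℂ)‖) ≤ Real.log (12 + δ) + Real.log R := by
      rw [← Real.log_mul (by positivity) (by positivity)]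
      refine Real.log_le_log (by positivity) ?_
      nlinarith
    have := le_abs_self C₀
    linarith
  have main := norm_le_blaschke_mul_exp (z₀ := (x₀ : ℂ)) (D := 1 + δ) (A := A) (R := R) (K := 11) hδ
    (by linarith) (by norm_num) hhd ((hfin R).toFinset.image fun w : ℂ => w - δ)
    (by
      intro w' hw'
      obtain ⟨w, hw, rfl⟩ := Finset.mem_image.1 hw'
      simpa [hh] using hZ w (hmem.1 hw).1)
    (by
      intro w' hw'
      obtain ⟨w, hw, rfl⟩ := Finset.mem_image.1 hw'
      have := hre hw
      simp; linarith)
    (by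
      intro w' hw'
      obtain ⟨w, hw, rfl⟩ := Finset.mem_image.1 hw'
      exact (re_one_div_sub_le hδ (hre hw)).2.trans (hmem.1 hw).2)
    hgrowth (by simpa using hx₀pos)
    (by rw [Complex.norm_real, Real.norm_of_nonneg hx₀pos.le]; linarith)
  rw [Finset.sum_image fun _ _ _ _ h => hinj h, Finset.sum_image fun _ _ _ _ h => hinj h] at main
  set S' : ℝ := ∑ w ∈ (hfin R).toFinset, (1 / (w - δ)).re with hS'
  have hreS : ∀ {R w}, w ∈ (hfin R).toFinset → 0 ≤ (1 / (w - (δ : ℂ))).re := fun hw => by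
    have := hre hw
    exact re_one_div_nonneg (by simp; linarith)
  have hS'T : 9 / 10 * ∑ w ∈ (hfin R).toFinset, (1 / w).re ≤ S' := by
    rw [Finset.mul_sum]
    exact Finset.sum_le_sum fun w hw => (re_one_div_sub_le hδ (hre hw)).1
  have hcl : ∑ w ∈ (hfin R).toFinset, (if ‖w - (δ : ℂ)‖ < L then (1 / (w - (δ : ℂ))).re else 0)
      ≤ CL := by
    rw [← Finset.sum_filter]
    refine Finset.sum_le_sum_of_subset_of_nonneg (fun w hw => ?_) fun w hw _ => hreS hw
    rw [Finset.mem_filter] at hw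
    refine hmem.2 ⟨(hmem.1 hw.1).1, ?_⟩
    have h1 := norm_add_le (w - (δ : ℂ)) δ
    rw [sub_add_cancel, Complex.norm_real, Real.norm_of_nonneg hδ.le] at h1
    linarith [hw.2]
  have hlow : 2 * x₀ * (98 / 100 * S' - CL) ≤ ∑ w ∈ (hfin R).toFinset,
      2 * (x₀ : ℂ).re * (w - (δ : ℂ)).re / ‖(x₀ : ℂ) + (starRingEnd ℂ) (w - (δ : ℂ))‖ ^ 2 := by
    refine le_trans ?_ (Finset.sum_le_sum fun w hw => blaschke_exponent_ge hx₀pos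
      (by have := hre hw; simp; linarith) hL)
    rw [← Finset.mul_sum, Finset.sum_sub_distrib, ← Finset.mul_sum]
    refine mul_le_mul_of_nonneg_left ?_ (by positivity)
    linarith
  have hlog := Real.log_le_log (norm_pos_iff.2 hhx₀) main
  rw [Real.log_exp, Complex.ofReal_re] at hlog
  rw [Complex.ofReal_re] at hlow
  have hDA : (1 + δ + x₀) * A ≤ 101 / 100 * x₀ * A := by
    refine mul_le_mul_of_nonneg_right ?_ hA0
    linarith
  have habs := neg_abs_le (Real.log ‖h x₀‖)
  have hfinal : 2 * x₀ * (97 / 100 * S') ≤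
      2 * x₀ * (CL + 505 / 1000 * A + |Real.log ‖h x₀‖| / (2 * x₀)) := by
    have e : 2 * x₀ * (|Real.log ‖h x₀‖| / (2 * x₀)) = |Real.log ‖h x₀‖| := by field_simp
    rw [mul_add, e]
    rw [show 2 * x₀ / (11 - 1) ^ 2 = 2 * x₀ / 100 by norm_num] at hlog
    linarith
  have h5 := le_of_mul_le_mul_left hfinal (by positivity)
  have e2 : 873 / 1000 * C = CL + 505 / 1000 * c₁ + |Real.log ‖h x₀‖| / (2 * x₀) := by
    rw [hC]; field_simp
  rw [hA] at h5
  linarith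

theorem carlemanSum_eq {Z : Set ℂ} (hZre : ∀ w ∈ Z, 0 ≤ w.re) {R : ℝ}
    (hfin : {w | w ∈ Z ∧ ‖w‖ ≤ R}.Finite) :
    carlemanSum Z R = ENNReal.ofReal (∑ w ∈ hfin.toFinset, (1 / w).re) := by
  rw [ENNReal.ofReal_sum_of_nonneg fun w hw => re_one_div_nonneg (hZre w (by simp at hw; exact hw.1)),
    carlemanSum]
  have e := tsum_subtype {w : ℂ | w ∈ Z ∧ ‖w‖ ≤ R} fun w : ℂ => ENNReal.ofReal (1 / w).re
  refine e.trans ?_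
  rw [tsum_eq_sum (s := hfin.toFinset) fun w hw => Set.indicator_of_notMem (by simpa using hw) _]
  exact Finset.sum_congr rfl fun w hw => Set.indicator_of_mem (by simpa using hw) _

/-- A function of the given growth with too many zeros vanishes. -/
theorem eq_zero_of_hasGrowth {f : ℂ → ℂ} (hf : DifferentiableOn ℂ f rightHalfPlane)
    (hg : HasGrowth f) {Z : Set ℂ} {ε₀ : ℝ} (hε₀ : 0 < ε₀) (hZre : ∀ w ∈ Z, ε₀ ≤ w.re)
    (hZ : ∀ w ∈ Z, f w = 0) (hviol : ¬ CarlemanCondition Z) :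
    ∀ z ∈ rightHalfPlane, f z = 0 := by
  by_contra hne
  refine hviol ?_
  have hfin := finite_zeros_of_ne_zero hf hε₀ hZre hZ hne
  obtain ⟨C, hC⟩ := exists_sum_re_one_div_le hf hg hε₀ hZre hZ hne hfin
  refine limsup_le_of_le (by isBoundedDefault) ?_
  -- The gap between `3/5` and `63/100 ≤ 2/π` absorbs `C` once `log R` exceeds `100 |C|`.
  filter_upwards [hC, Real.tendsto_log_atTop.eventually_ge_atTop (1 + 100 * |C|)] with R hR hlog
  rw [carlemanSum_eq (fun w hw => hε₀.le.trans (hZre w hw)) (hfin R),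
    ← ENNReal.ofReal_div_of_pos (by linarith [abs_nonneg C])]
  refine ENNReal.ofReal_le_ofReal ?_
  have hπ : (63 / 100 : ℝ) ≤ 2 / Real.pi := by
    rw [le_div_iff₀ Real.pi_pos]
    linarith [Real.pi_lt_d2]
  have hpos : 0 < Real.log R := by linarith [abs_nonneg C]
  refine le_trans ?_ hπ
  rw [div_le_iff₀ hpos]
  linarith [le_abs_self C]

/-! ### Holomorphic dependence of integrals on a parameter. -/

/-- Holomorphy of a parametric integral under a locally uniform integrable bound. -/
theorem differentiableOn_integral_of_dominated {α : Type*} [MeasurableSpace α] {μ : Measure α}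
    {U : Set ℂ} {k : ℂ → α → ℂ}
    (hk : ∀ᵐ t ∂μ, DifferentiableOn ℂ (fun z => k z t) U)
    (hm : ∀ z ∈ U, AEStronglyMeasurable (k z) μ)
    (hb : ∀ z₀ ∈ U, ∃ r > 0, Metric.ball z₀ r ⊆ U ∧ ∃ b : α → ℝ, Integrable b μ ∧
      ∀ᵐ t ∂μ, ∀ z ∈ Metric.ball z₀ r, ‖k z t‖ ≤ b t) :
    DifferentiableOn ℂ (fun z => ∫ t, k z t ∂μ) U := by
  intro z₀ hz₀
  obtain ⟨r, hr, hrU, b, hbint, hb⟩ := hb z₀ hz₀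
  refine DifferentiableAt.differentiableWithinAt ?_
  have hat : ∀ᵐ t ∂μ, ∀ z ∈ Metric.ball z₀ r, HasDerivAt (fun z => k z t)
      (deriv (fun z => k z t) z) z := by
    filter_upwards [hk] with t ht z hz
    exact ((ht.mono hrU).differentiableAt (Metric.isOpen_ball.mem_nhds hz)).hasDerivAt
  have hz₀b : z₀ ∈ Metric.ball z₀ r := Metric.mem_ball_self hr
  refine (hasDerivAt_integral_of_dominated_loc_of_deriv_le
    (F' := fun z t => deriv (fun z => k z t) z) (bound := fun t => b t / (r / 2))
    (Metric.ball_mem_nhds z₀ (half_pos (half_pos hr))) ?_ ?_ ?_ ?_ (hbint.div_const _)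
    ?_).2.differentiableAt
  · filter_upwards [Metric.ball_mem_nhds z₀ hr] with z hz using hm z (hrU hz)
  · exact hbint.mono' (hm z₀ hz₀) (hb.mono fun t ht => ht z₀ hz₀b)
  -- The derivative in `z` is measurable in `t` as a limit of difference quotients along a sequence.
  · set u : ℕ → ℂ := fun n => ((r / 2 / (n + 1) : ℝ) : ℂ) with hu
    have hu0 : Tendsto u atTop (𝓝[≠] 0) := by
      refine tendsto_nhdsWithin_iff.2 ⟨?_, Eventually.of_forall fun n => ?_⟩
      · have h1 : Tendsto (fun n : ℕ => r / 2 / ((n : ℝ) + 1)) atTop (𝓝 0) := by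
          have := (tendsto_one_div_add_atTop_nhds_zero_nat (𝕜 := ℝ)).const_mul (r / 2)
          simpa [div_eq_mul_inv] using this
        exact (Complex.continuous_ofReal.tendsto' 0 0 rfl).comp h1
      · have : r / 2 / ((n : ℝ) + 1) ≠ 0 := by positivity
        simpa only [hu, Set.mem_compl_iff, Set.mem_singleton_iff, Complex.ofReal_eq_zero] using this
    have hub : ∀ n, z₀ + u n ∈ Metric.ball z₀ r := fun n => by
      rw [Metric.mem_ball, dist_eq_norm, add_sub_cancel_left, hu, Complex.norm_real,
        Real.norm_of_nonneg (by positivity)]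
      have : r / 2 / ((n : ℝ) + 1) ≤ r / 2 := div_le_self (by positivity) (by linarith [n.cast_nonneg (α := ℝ)])
      linarith
    refine aestronglyMeasurable_of_tendsto_ae atTop
      (f := fun n t => (u n)⁻¹ • (k (z₀ + u n) t - k z₀ t)) (fun n => ?_) ?_
    · exact AEStronglyMeasurable.const_smul (𝕜 := ℂ) ((hm _ (hrU (hub n))).sub (hm _ hz₀)) _
    · filter_upwards [hat] with t ht
      exact ((hasDerivAt_iff_tendsto_slope_zero.1 (ht z₀ hz₀b)).comp hu0)
  -- Cauchy's estimate on a circle of radius `r/2`, which stays in the ball of radius `r`.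
  · filter_upwards [hb, hk] with t ht hkt z hz
    have hsub : Metric.closedBall z (r / 2) ⊆ Metric.ball z₀ r := by
      refine Metric.closedBall_subset_ball' ?_
      have := Metric.mem_ball.1 hz
      linarith
    refine Complex.norm_deriv_le_of_forall_mem_sphere_norm_le (half_pos hr) ?_
      fun w hw => ht w (hsub (Metric.sphere_subset_closedBall hw))
    refine ((hkt.mono hrU).mono ?_).diffContOnCl
    exact (closure_minimal Metric.ball_subset_closedBall Metric.isClosed_closedBall).trans hsub
  · filter_upwards [hat] with t ht z hz
    exact ht z (Metric.ball_subset_ball (by linarith) hz)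

/-! ### Pointwise bounds from square means on vertical lines. -/

/-- Mean value property of the holomorphic function `f²` on a circle. -/
theorem two_pi_mul_enorm_sq_le {f : ℂ → ℂ} {c : ℂ} {r ρ : ℝ} (hρ : 0 < ρ) (hρr : ρ < r)
    (hf : DifferentiableOn ℂ f (Metric.ball c r)) :
    ENNReal.ofReal (2 * Real.pi) * ‖f c‖ₑ ^ 2 ≤
      ∫⁻ θ in Set.Ioo (-Real.pi) Real.pi, ‖f (c + Complex.polarCoord.symm (ρ, θ))‖ₑ ^ 2 := by
  have hg : DiffContOnCl ℂ (fun z => f z ^ 2) (Metric.ball c |ρ|) := by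
    rw [abs_of_pos hρ]
    refine ((hf.pow 2).mono ?_).diffContOnCl
    exact (closure_minimal Metric.ball_subset_closedBall Metric.isClosed_closedBall).trans
      (Metric.closedBall_subset_ball hρr)
  have h1 := hg.circleAverage
  rw [Real.circleAverage_eq_integral_add (-Real.pi), intervalIntegral.integral_comp_add_right
    (fun θ => f (circleMap c ρ θ) ^ 2)] at h1
  have h2 : ((2 * Real.pi : ℝ) : ℂ) * f c ^ 2 =
      ∫ θ in Set.Ioo (-Real.pi) Real.pi, f (circleMap c ρ θ) ^ 2 := by
    rw [← h1, intervalIntegral.integral_of_le (by linarith [Real.pi_pos]),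
      ← integral_Ioc_eq_integral_Ioo, Complex.real_smul, ← mul_assoc, ← Complex.ofReal_mul,
      mul_inv_cancel₀ (by positivity), Complex.ofReal_one, one_mul]
    congr 2
    ring_nf
  calc ENNReal.ofReal (2 * Real.pi) * ‖f c‖ₑ ^ 2
      = ‖((2 * Real.pi : ℝ) : ℂ) * f c ^ 2‖ₑ := by
        rw [enorm_mul, enorm_pow, ← ofReal_norm ((2 * Real.pi : ℝ) : ℂ), Complex.norm_real,
          Real.norm_of_nonneg (by positivity)]
    _ ≤ ∫⁻ θ in Set.Ioo (-Real.pi) Real.pi, ‖f (circleMap c ρ θ) ^ 2‖ₑ := by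
        rw [h2]; exact enorm_integral_le_lintegral_enorm _
    _ = _ := by
        refine lintegral_congr fun θ => ?_
        rw [enorm_pow, Complex.polarCoord_symm_apply, circleMap, Complex.exp_mul_I]
        simp

/-- The area mean value inequality for `|f|²`, with a crude constant. -/
theorem sq_mul_enorm_sq_le_lintegral_ball {f : ℂ → ℂ} {c : ℂ} {r : ℝ} (hr : 0 < r)
    (hf : DifferentiableOn ℂ f (Metric.ball c r)) :
    ENNReal.ofReal (r ^ 2) * ‖f c‖ₑ ^ 2 ≤ ∫⁻ ζ in Metric.ball 0 r, ‖f (c + ζ)‖ₑ ^ 2 := by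
  -- Only the outer annulus is kept: there the polar weight is at least `r/2`, and `(r/2)(r/2)(2π) ≥
  -- r²`.
  set A : Set ℝ := Set.Ioo (r / 2) r with hA
  set B : Set ℝ := Set.Ioo (-Real.pi) Real.pi with hB
  have hpolar : Continuous fun p : ℝ × ℝ => c + Complex.polarCoord.symm p := by
    simp only [Complex.polarCoord_symm_apply]; fun_prop
  have hmaps : ∀ p ∈ A ×ˢ B, c + Complex.polarCoord.symm p ∈ Metric.ball c r := by
    rintro p ⟨hp, -⟩
    rw [Metric.mem_ball, dist_eq_norm, add_sub_cancel_left, Complex.norm_polarCoord_symm,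
      abs_of_pos ((half_pos hr).trans hp.1)]
    exact hp.2
  have hmeas : AEMeasurable (fun p : ℝ × ℝ => ‖f (c + Complex.polarCoord.symm p)‖ₑ ^ 2)
      (volume.restrict (A ×ˢ B)) := by
    have h1 : ContinuousOn (fun p : ℝ × ℝ => f (c + Complex.polarCoord.symm p)) (A ×ˢ B) :=
      hf.continuousOn.comp hpolar.continuousOn hmaps
    exact (h1.aemeasurable (measurableSet_Ioo.prod measurableSet_Ioo)).enorm.pow_const 2
  rw [← lintegral_indicator measurableSet_ball, ← Complex.lintegral_comp_polarCoord_symm]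
  calc ENNReal.ofReal (r ^ 2) * ‖f c‖ₑ ^ 2
      ≤ ∫⁻ ρ in A, ENNReal.ofReal (r / 2) * (ENNReal.ofReal (2 * Real.pi) * ‖f c‖ₑ ^ 2) := by
        rw [setLIntegral_const, hA, Real.volume_Ioo, mul_right_comm, ← mul_assoc,
          ← ENNReal.ofReal_mul (by positivity), ← ENNReal.ofReal_mul (by nlinarith)]
        gcongr
        nlinarith [Real.pi_gt_three, sq_nonneg r]
    _ ≤ ∫⁻ ρ in A, ∫⁻ θ in B,
          ENNReal.ofReal (r / 2) * ‖f (c + Complex.polarCoord.symm (ρ, θ))‖ₑ ^ 2 := by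
        refine setLIntegral_mono' measurableSet_Ioo fun ρ hρ => ?_
        rw [lintegral_const_mul' _ _ ENNReal.ofReal_ne_top]
        gcongr
        exact two_pi_mul_enorm_sq_le ((half_pos hr).trans hρ.1) hρ.2 hf
    _ = ∫⁻ p in A ×ˢ B, ENNReal.ofReal (r / 2) * ‖f (c + Complex.polarCoord.symm p)‖ₑ ^ 2 := by
        rw [Measure.volume_eq_prod, ← Measure.prod_restrict, lintegral_prod]
        rw [Measure.prod_restrict]
        exact hmeas.const_mul _
    _ ≤ ∫⁻ p in A ×ˢ B, ENNReal.ofReal p.1 • (Metric.ball (0 : ℂ) r).indicator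
          (fun ζ => ‖f (c + ζ)‖ₑ ^ 2) (Complex.polarCoord.symm p) := by
        refine setLIntegral_mono' (measurableSet_Ioo.prod measurableSet_Ioo) fun p hp => ?_
        have := hmaps p hp
        rw [Set.indicator_of_mem (by simpa using this), smul_eq_mul]
        gcongr
        exact hp.1.1.le
    _ ≤ _ := by
        refine lintegral_mono_set fun p hp => ⟨?_, hp.2⟩
        exact (half_pos hr).trans hp.1.1

/-- The square integral of `f` over the vertical line with abscissa `x`. -/
def lineIntegralSq (f : ℂ → ℂ) (x : ℝ) : ℝ≥0∞ := ∫⁻ y : ℝ, ‖f ⟨x, y⟩‖ₑ ^ 2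

/-- The disc lies in a vertical strip of width `2r`, over which the area integral is computed line
by line. -/
theorem enorm_sq_le_of_lineIntegralSq_le {f : ℂ → ℂ} {c : ℂ} {r : ℝ} (hr : 0 < r)
    (hf : DifferentiableOn ℂ f {z | |z.re - c.re| < r}) {M : ℝ≥0∞}
    (hM : ∀ x, |x - c.re| < r → lineIntegralSq f x ≤ M) :
    ENNReal.ofReal (r ^ 2) * ‖f c‖ₑ ^ 2 ≤ ENNReal.ofReal (2 * r) * M := by
  have hball : Metric.ball c r ⊆ {z | |z.re - c.re| < r} := fun z hz => by
    have h1 := Complex.abs_re_le_norm (z - c)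
    rw [Metric.mem_ball, dist_eq_norm] at hz
    simpa using h1.trans_lt hz
  refine (sq_mul_enorm_sq_le_lintegral_ball hr (hf.mono hball)).trans ?_
  set e := Complex.measurableEquivRealProd
  have he : MeasurePreserving e.symm volume volume := Complex.volume_preserving_equiv_real_prod.symm
  calc ∫⁻ ζ in Metric.ball 0 r, ‖f (c + ζ)‖ₑ ^ 2
      = ∫⁻ p in e.symm ⁻¹' Metric.ball 0 r, ‖f (c + e.symm p)‖ₑ ^ 2 :=
        (he.setLIntegral_comp_preimage_emb e.symm.measurableEmbedding
          (fun ζ => ‖f (c + ζ)‖ₑ ^ 2) _).symm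
    _ ≤ ∫⁻ p in Set.Ioo (-r) r ×ˢ Set.univ, ‖f (c + e.symm p)‖ₑ ^ 2 := by
        refine lintegral_mono_set fun p hp => ⟨?_, trivial⟩
        have h1 := Complex.abs_re_le_norm (e.symm p)
        have h2 : ‖e.symm p‖ < r := by simpa using hp
        exact abs_lt.1 (h1.trans_lt h2)
    _ ≤ ∫⁻ s in Set.Ioo (-r) r, ∫⁻ t in Set.univ, ‖f (c + e.symm (s, t))‖ₑ ^ 2 := by
        rw [Measure.volume_eq_prod, ← Measure.prod_restrict]
        exact lintegral_prod_le _
    _ ≤ ∫⁻ s in Set.Ioo (-r) r, M := by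
        refine setLIntegral_mono' measurableSet_Ioo fun s hs => ?_
        rw [Measure.restrict_univ]
        refine le_trans (le_of_eq ?_) (hM (c.re + s) (by simpa [abs_lt] using hs))
        rw [lineIntegralSq, ← lintegral_add_left_eq_self (fun y : ℝ => ‖f ⟨c.re + s, y⟩‖ₑ ^ 2) c.im]
        rfl
    _ = ENNReal.ofReal (2 * r) * M := by
        rw [setLIntegral_const, Real.volume_Ioo, mul_comm]; congr 2; ring

/-! ### The three lines theorem for square means. -/

theorem continuous_shift_line {f : ℂ → ℂ} (hf : DifferentiableOn ℂ f rightHalfPlane) {z : ℂ}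
    (hz : 0 < z.re) : Continuous fun t : ℝ => f (z + t * Complex.I) :=
  hf.continuousOn.comp_continuous (by fun_prop) fun t => by simpa [rightHalfPlane] using hz

theorem lineIntegralSq_eq_shift (f : ℂ → ℂ) (z : ℂ) :
    lineIntegralSq f z.re = ∫⁻ t : ℝ, ‖f (z + t * Complex.I)‖ₑ ^ 2 := by
  rw [lineIntegralSq, ← lintegral_add_left_eq_self (fun y : ℝ => ‖f ⟨z.re, y⟩‖ₑ ^ 2) z.im]
  refine lintegral_congr fun t => ?_
  congr 3
  apply Complex.ext <;> simp

theorem integral_norm_sq_le {f : ℂ → ℂ} (hf : DifferentiableOn ℂ f rightHalfPlane) {z : ℂ}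
    (hz : 0 < z.re) {M : ℝ} (hM0 : 0 ≤ M) (hM : lineIntegralSq f z.re ≤ ENNReal.ofReal M) (T : ℝ) :
    ∫ t in Set.Icc (-T) T, ‖f (z + t * Complex.I)‖ ^ 2 ≤ M := by
  have hc := continuous_shift_line hf hz
  rw [integral_eq_lintegral_of_nonneg_ae (Eventually.of_forall fun t => by positivity)
    (by exact (hc.norm.pow 2).aestronglyMeasurable)]
  refine ENNReal.toReal_le_of_le_ofReal hM0 (le_trans ?_ hM)
  rw [lineIntegralSq_eq_shift]
  refine (setLIntegral_le_lintegral _ _).trans (le_of_eq (lintegral_congr fun t => ?_))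
  rw [ENNReal.ofReal_pow (norm_nonneg _), ofReal_norm]

theorem lineIntegralSq_le_of_forall {f : ℂ → ℂ} (hf : DifferentiableOn ℂ f rightHalfPlane) {s : ℝ}
    (hs : 0 < s) {M : ℝ}
    (h : ∀ T : ℝ, 0 < T → ∫ t in Set.Icc (-T) T, ‖f (s + t * Complex.I)‖ ^ 2 ≤ M) :
    lineIntegralSq f s ≤ ENNReal.ofReal M := by
  have hc := continuous_shift_line hf (z := s) (by simpa using hs)
  have h1 := lineIntegralSq_eq_shift f (s : ℂ)
  rw [Complex.ofReal_re] at h1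
  rw [h1]
  have hcov := aecover_Icc (μ := (volume : Measure ℝ)) tendsto_neg_atTop_atBot
    (tendsto_id (α := ℝ) (x := atTop))
  have ht := hcov.lintegral_tendsto_of_countably_generated
    (f := fun t : ℝ => ‖f (s + t * Complex.I)‖ₑ ^ 2)
    (hc.measurable.enorm.pow_const 2).aemeasurable
  refine le_of_tendsto ht ?_
  filter_upwards [eventually_gt_atTop 0] with T hT
  have hi : IntegrableOn (fun t : ℝ => ‖f (s + t * Complex.I)‖ ^ 2) (Set.Icc (-T) T) :=
    (hc.norm.pow 2).continuousOn.integrableOn_Icc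
  refine le_trans (le_of_eq ?_) (ENNReal.ofReal_le_ofReal (h T hT))
  rw [ofReal_integral_eq_lintegral_ofReal hi (Eventually.of_forall fun t => by positivity)]
  refine lintegral_congr fun t => ?_
  rw [ENNReal.ofReal_pow (norm_nonneg _), ofReal_norm]

/-- The correlation of `f` with its values on a segment of the line with abscissa `s`. -/
def lineCorrelation (f : ℂ → ℂ) (s T : ℝ) (z : ℂ) : ℂ :=
  ∫ t in Set.Icc (-T) T, f (z + t * Complex.I) * (starRingEnd ℂ) (f (s + t * Complex.I))

theorem differentiableOn_lineCorrelation {f : ℂ → ℂ} (hf : DifferentiableOn ℂ f rightHalfPlane)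
    {s : ℝ} (hs : 0 < s) (T : ℝ) :
    DifferentiableOn ℂ (lineCorrelation f s T) rightHalfPlane := by
  have hcs := continuous_shift_line hf (z := s) (by simpa using hs)
  refine differentiableOn_integral_of_dominated (Eventually.of_forall fun t => ?_) (fun z hz => ?_)
    fun z₀ hz₀ => ?_
  · refine DifferentiableOn.mul_const (hf.comp (by fun_prop) fun z hz => ?_) _
    simpa [rightHalfPlane] using hz
  · have hcz := continuous_shift_line hf hz
    exact (hcz.mul (Complex.continuous_conj.comp hcs)).aestronglyMeasurable
  · have hz₀' : 0 < z₀.re := hz₀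
    have hsub : Metric.closedBall z₀ (z₀.re / 2) ⊆ rightHalfPlane := fun z hz => by
      have h1 := Complex.abs_re_le_norm (z - z₀)
      rw [Metric.mem_closedBall, dist_eq_norm] at hz
      have h2 := abs_le.1 (h1.trans hz)
      rw [Complex.sub_re] at h2
      show 0 < z.re
      linarith [h2.1]
    have hc2 : ContinuousOn (fun p : ℂ × ℝ => f (p.1 + p.2 * Complex.I) *
        (starRingEnd ℂ) (f (s + p.2 * Complex.I)))
        (Metric.closedBall z₀ (z₀.re / 2) ×ˢ Set.Icc (-T) T) := by
      refine (hf.continuousOn.comp (by fun_prop) fun p hp => ?_).mul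
        (Complex.continuous_conj.comp (hcs.comp continuous_snd)).continuousOn
      simpa [rightHalfPlane] using hsub hp.1
    obtain ⟨C, hC⟩ := ((isCompact_closedBall z₀ (z₀.re / 2)).prod isCompact_Icc).exists_bound_of_continuousOn hc2
    refine ⟨z₀.re / 2, by positivity, Metric.ball_subset_closedBall.trans hsub, fun _ => C,
      integrable_const C, ?_⟩
    filter_upwards [ae_restrict_mem measurableSet_Icc] with t ht z hz
    exact hC (z, t) ⟨Metric.ball_subset_closedBall hz, ht⟩

/-- By `ab ≤ (a² + b²)/2`. The second half of the bound is later absorbed by the value of the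
correlation at `z = s`. -/
theorem norm_lineCorrelation_le {f : ℂ → ℂ} (hf : DifferentiableOn ℂ f rightHalfPlane)
    {s : ℝ} (hs : 0 < s) {T : ℝ} {z : ℂ} (hz : 0 < z.re) {M : ℝ} (hM0 : 0 ≤ M)
    (hM : lineIntegralSq f z.re ≤ ENNReal.ofReal M) :
    ‖lineCorrelation f s T z‖ ≤
      (M + ∫ t in Set.Icc (-T) T, ‖f (s + t * Complex.I)‖ ^ 2) / 2 := by
  have hcs := continuous_shift_line hf (z := s) (by simpa using hs)
  have hcz := continuous_shift_line hf hz
  have hi1 : IntegrableOn (fun t : ℝ => ‖f (z + t * Complex.I)‖ ^ 2) (Set.Icc (-T) T) :=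
    (hcz.norm.pow 2).continuousOn.integrableOn_Icc
  have hi2 : IntegrableOn (fun t : ℝ => ‖f (s + t * Complex.I)‖ ^ 2) (Set.Icc (-T) T) :=
    (hcs.norm.pow 2).continuousOn.integrableOn_Icc
  have h1 := integral_norm_sq_le hf hz hM0 hM T
  calc ‖lineCorrelation f s T z‖
      ≤ ∫ t in Set.Icc (-T) T,
          (‖f (z + t * Complex.I)‖ ^ 2 + ‖f (s + t * Complex.I)‖ ^ 2) / 2 := by
        refine norm_integral_le_of_norm_le ((hi1.add hi2).div_const 2)
          (Eventually.of_forall fun t => ?_)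
        rw [norm_mul, RCLike.norm_conj]
        nlinarith [sq_nonneg (‖f (z + t * Complex.I)‖ - ‖f (s + t * Complex.I)‖)]
    _ = ((∫ t in Set.Icc (-T) T, ‖f (z + t * Complex.I)‖ ^ 2) +
          ∫ t in Set.Icc (-T) T, ‖f (s + t * Complex.I)‖ ^ 2) / 2 := by
        rw [integral_div, integral_add hi1 hi2]
    _ ≤ _ := by gcongr

/-- The three lines theorem for square means over vertical lines. -/
theorem lineIntegralSq_le_of_boundary {f : ℂ → ℂ} (hf : DifferentiableOn ℂ f rightHalfPlane)
    {a b s M N : ℝ} (ha : 0 < a) (hab : a < b) (hs : s ∈ Set.Icc a b) (hM0 : 0 ≤ M)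
    (hN0 : 0 ≤ N) (hN : ∀ x ∈ Set.Icc a b, lineIntegralSq f x ≤ ENNReal.ofReal N)
    (hMa : lineIntegralSq f a ≤ ENNReal.ofReal M) (hMb : lineIntegralSq f b ≤ ENNReal.ofReal M) :
    lineIntegralSq f s ≤ ENNReal.ofReal M := by
  have hs0 : 0 < s := ha.trans_le hs.1
  refine lineIntegralSq_le_of_forall hf hs0 fun T _ => ?_
  set m := ∫ t in Set.Icc (-T) T, ‖f (s + t * Complex.I)‖ ^ 2 with hm
  have hG := differentiableOn_lineCorrelation hf hs0 T
  have hcl : closure (Complex.re ⁻¹' Set.Ioo a b) ⊆ rightHalfPlane := by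
    have : closure (Complex.re ⁻¹' Set.Ioo a b) ⊆ Complex.re ⁻¹' Set.Icc a b :=
      closure_minimal (Set.preimage_mono Set.Ioo_subset_Icc_self)
        (isClosed_Icc.preimage Complex.continuous_re)
    exact this.trans fun z hz => ha.trans_le hz.1
  -- At `z = s` the correlation equals `m`, so the conclusion reads `m ≤ (M + m)/2`, that is `m ≤
  -- M`. The bound `N` only provides the boundedness required by Phragmén–Lindelöf and leaves no
  -- trace.
  have hpl := PhragmenLindelof.vertical_strip (f := lineCorrelation f s T) (C := (M + m) / 2)
    (z := (s : ℂ)) (hG.mono hcl).diffContOnCl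
    ⟨0, div_pos Real.pi_pos (sub_pos.2 hab), 0, ?_⟩ ?_ ?_ hs.1 hs.2
  · have hval : lineCorrelation f s T s = (m : ℂ) := by
      rw [lineCorrelation, hm, ← integral_complex_ofReal]
      refine integral_congr_ae (Eventually.of_forall fun t => ?_)
      simp only
      rw [Complex.mul_conj, Complex.normSq_eq_norm_sq]
    rw [hval, Complex.norm_real] at hpl
    linarith [Real.le_norm_self m]
  · refine Asymptotics.IsBigO.of_bound ((N + m) / 2) ?_
    refine eventually_inf_principal.2 (Eventually.of_forall fun z hz => ?_)
    refine (norm_lineCorrelation_le hf hs0 (ha.trans hz.1) hN0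
      (hN z.re (Set.Ioo_subset_Icc_self hz))).trans (le_of_eq ?_)
    simp [hm]
  · rintro z rfl
    exact norm_lineCorrelation_le hf hs0 ha hM0 hMa
  · rintro z rfl
    exact norm_lineCorrelation_le hf hs0 (ha.trans hab) hM0 hMb

/-! ### Growth of the functions of `M²_ω`. -/

theorem measurableEmbedding_complexMk (x : ℝ) : MeasurableEmbedding fun y : ℝ => (⟨x, y⟩ : ℂ) :=
  Complex.measurableEquivRealProd.symm.measurableEmbedding.comp (measurableEmbedding_prodMk_left x)

/-- A single term of the series is bounded by the whole. The weight `2ⁿ` is discarded, which affects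
only the constant in `HasGrowth`; `n = 0` is left out since `withBoundary` takes the values of `g`
there. -/
theorem lineIntegralSq_le_of_memLp_omega {f : ℂ → ℂ} {g : ℝ → ℂ}
    (h : MemLp (withBoundary f g) 2 omega) :
    ∃ I : ℝ, 0 ≤ I ∧ ∀ n : ℕ, 1 ≤ n →
      lineIntegralSq f ((n : ℝ) / 2) ≤ ENNReal.ofReal (I * n.factorial) := by
  have h1 := (eLpNorm_lt_top_iff_lintegral_rpow_enorm_lt_top two_ne_zero ENNReal.ofNat_ne_top).1
    h.eLpNorm_lt_top
  set I := ∫⁻ z, ‖withBoundary f g z‖ₑ ^ (2 : ℝ≥0∞).toReal ∂omega with hI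
  refine ⟨I.toReal, ENNReal.toReal_nonneg, fun n hn => ?_⟩
  have h2 : ENNReal.ofReal (2 ^ n / (n.factorial : ℝ)) * lineIntegralSq f ((n : ℝ) / 2) ≤ I := by
    rw [hI, omega, lintegral_sum_measure]
    refine le_trans (le_of_eq ?_) (ENNReal.le_tsum n)
    rw [lintegral_smul_measure, (measurableEmbedding_complexMk _).lintegral_map, smul_eq_mul,
      lineIntegralSq]
    congr 1
    refine lintegral_congr fun y => ?_
    have : (0 : ℝ) < (n : ℝ) / 2 := by positivity
    rw [withBoundary, if_pos this, ENNReal.toReal_ofNat, ENNReal.rpow_ofNat]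
  have hfac : (0 : ℝ) < n.factorial := by positivity
  rw [ENNReal.ofReal_mul ENNReal.toReal_nonneg, ENNReal.ofReal_toReal h1.ne]
  calc lineIntegralSq f ((n : ℝ) / 2)
      ≤ ENNReal.ofReal n.factorial *
        (ENNReal.ofReal (2 ^ n / (n.factorial : ℝ)) * lineIntegralSq f ((n : ℝ) / 2)) := by
        rw [← mul_assoc, ← ENNReal.ofReal_mul hfac.le, mul_div_cancel₀ _ hfac.ne']
        refine le_mul_of_one_le_left zero_le ?_
        rw [ENNReal.one_le_ofReal]
        exact one_le_pow₀ one_le_two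
    _ ≤ ENNReal.ofReal n.factorial * I := by gcongr
    _ = _ := mul_comm _ _

theorem exists_lineIntegralSq_le_rpow {f : ℂ → ℂ} (h : MemM2 f) :
    ∃ J : ℝ, 0 ≤ J ∧ ∀ x s : ℝ, 0 < x → 0 < s → |s - x| < 1 / 2 →
      lineIntegralSq f s ≤ ENNReal.ofReal (J * (2 * (1 + x)) ^ (2 * (1 + x))) := by
  obtain ⟨hf, hstrip, g, -, hg⟩ := h
  obtain ⟨I, hI0, hI⟩ := lineIntegralSq_le_of_memLp_omega hg
  have hbdd : ∀ b : ℝ, 0 < b → ∃ N : ℝ, 0 ≤ N ∧ ∀ x ∈ Set.Ioo 0 b,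
      lineIntegralSq f x ≤ ENNReal.ofReal N := by
    intro b hb
    refine ⟨(⨆ x ∈ Set.Ioo (0 : ℝ) b, ∫⁻ y : ℝ, ‖f ⟨x, y⟩‖ₑ ^ 2).toReal, ENNReal.toReal_nonneg,
      fun x hx => ?_⟩
    rw [ENNReal.ofReal_toReal (hstrip b hb).2.ne]
    exact le_iSup₂ (f := fun x (_ : x ∈ Set.Ioo (0 : ℝ) b) => ∫⁻ y : ℝ, ‖f ⟨x, y⟩‖ₑ ^ 2) x hx
  obtain ⟨N, hN0, hN⟩ := hbdd 2 two_pos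
  refine ⟨N + I, add_nonneg hN0 hI0, fun x s hx hs hsx => ?_⟩
  have hsx' := abs_lt.1 hsx
  have hone : 1 ≤ (2 * (1 + x)) ^ (2 * (1 + x)) :=
    Real.one_le_rpow (by linarith) (by linarith)
  -- For `x ≤ 1` there may be no line of abscissa `n/2` with `n ≥ 1` to the left of `s`; the Hardy
  -- bound on the strip of width `2` is used instead.
  rcases le_or_gt x 1 with hx1 | hx1
  · refine (hN s ⟨hs, by linarith⟩).trans (ENNReal.ofReal_le_ofReal ?_)
    nlinarith
  · set n := ⌊2 * s⌋₊ with hn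
    have hn1 : 1 ≤ n := Nat.le_floor (by push_cast; linarith)
    have hns : (n : ℝ) ≤ 2 * s := Nat.floor_le (by linarith)
    have hns' : 2 * s < n + 1 := Nat.lt_floor_add_one _
    have hn1' : (1 : ℝ) ≤ n := by exact_mod_cast hn1
    obtain ⟨N', hN'0, hN'⟩ := hbdd (n + 1) (by linarith)
    have h1 : lineIntegralSq f s ≤ ENNReal.ofReal (I * (n + 1).factorial) := by
      refine lineIntegralSq_le_of_boundary hf (a := (n : ℝ) / 2) (b := ((n + 1 : ℕ) : ℝ) / 2)
        (by linarith) (by push_cast; linarith) ⟨by linarith, by push_cast; linarith⟩ (by positivity)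
        hN'0 (fun y hy => hN' y ⟨by linarith [hy.1], ?_⟩) ((hI n hn1).trans ?_)
        (hI (n + 1) (by omega))
      · have := hy.2
        push_cast at this
        linarith
      · refine ENNReal.ofReal_le_ofReal (mul_le_mul_of_nonneg_left ?_ hI0)
        exact_mod_cast Nat.factorial_le n.le_succ
    refine h1.trans (ENNReal.ofReal_le_ofReal ?_)
    -- `n + 1 ≤ 2 s + 1 ≤ 2 (1 + x)`, because `s < x + 1/2`.
    have h2 : ((n + 1).factorial : ℝ) ≤ (2 * (1 + x)) ^ (2 * (1 + x)) := by
      calc ((n + 1).factorial : ℝ) ≤ ((n + 1 : ℕ) : ℝ) ^ (n + 1) := by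
            exact_mod_cast Nat.factorial_le_pow (n + 1)
        _ ≤ (2 * (1 + x)) ^ (n + 1) := by
            gcongr
            push_cast; linarith
        _ = (2 * (1 + x)) ^ ((n + 1 : ℕ) : ℝ) := (Real.rpow_natCast _ _).symm
        _ ≤ _ := by
            refine Real.rpow_le_rpow_of_exponent_le (by linarith) ?_
            push_cast; linarith
    have := mul_nonneg hN0 (zero_le_one.trans hone)
    nlinarith [mul_le_mul_of_nonneg_left h2 hI0]

/-- Functions of `M²_ω` satisfy the growth condition. -/
theorem MemM2.hasGrowth {f : ℂ → ℂ} (h : MemM2 f) : HasGrowth f := by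
  intro δ hδ
  obtain ⟨J, hJ0, hJ⟩ := exists_lineIntegralSq_le_rpow h
  -- `r ≤ δ` keeps the strip around `z` in the half-plane, and `r ≤ 1/2` keeps it in the range of
  -- `hJ`.
  set r := min δ (1 / 2) with hr
  have hr0 : 0 < r := lt_min hδ (by norm_num)
  refine ⟨Real.log 2 + 2 * J / r, fun z hz => ?_⟩
  have hre : 0 < z.re := hδ.trans_le hz
  set x := z.re with hx
  have hsub : ∀ s : ℝ, |s - x| < r → 0 < s := fun s hs => by
    have := (abs_lt.1 hs).1
    have : r ≤ δ := min_le_left _ _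
    linarith
  have h1 := enorm_sq_le_of_lineIntegralSq_le (c := z) hr0
    (h.1.mono fun w hw => hsub w.re hw)
    fun s hs => hJ x s hre (hsub s hs) (hs.trans_le (min_le_right _ _))
  rw [← ofReal_norm, ← ENNReal.ofReal_pow (norm_nonneg _), ← ENNReal.ofReal_mul (by positivity),
    ← ENNReal.ofReal_mul (by positivity), ENNReal.ofReal_le_ofReal_iff (by positivity)] at h1
  have h2 : ‖f z‖ ^ 2 ≤ 2 * J / r * (2 * (1 + x)) ^ (2 * (1 + x)) := by
    rw [div_mul_eq_mul_div, le_div_iff₀ hr0]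
    refine le_of_mul_le_mul_left (le_trans (le_of_eq ?_) (h1.trans (le_of_eq ?_))) hr0 <;> ring
  -- The square root halves the exponent `2 (1 + x)`; hence the coefficient `1 + Re z` in
  -- `HasGrowth`.
  refine le_of_sq_le_sq (h2.trans ?_) (Real.exp_pos _).le
  have hlog : Real.log (2 * (1 + x)) ≤ Real.log (1 + ‖z‖) + Real.log 2 := by
    rw [← Real.log_mul (by positivity) (by positivity)]
    refine Real.log_le_log (by positivity) ?_
    have := Complex.re_le_norm z
    linarith
  have hJr : 0 ≤ 2 * J / r := by positivity
  have h3 : 2 * J / r ≤ Real.exp (2 * (1 + x) * (2 * J / r)) := by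
    have := Real.add_one_le_exp (2 * (1 + x) * (2 * J / r))
    nlinarith [mul_nonneg hre.le hJr]
  rw [Real.rpow_def_of_pos (by positivity), ← Real.exp_nat_mul]
  calc 2 * J / r * Real.exp (Real.log (2 * (1 + x)) * (2 * (1 + x)))
      ≤ Real.exp (2 * (1 + x) * (2 * J / r)) *
        Real.exp ((Real.log (1 + ‖z‖) + Real.log 2) * (2 * (1 + x))) := by gcongr
    _ = _ := by
      rw [← Real.exp_add]; congr 1; push_cast; ring

/-! ### Powers on the disc and their pairing with an `L²` function. -/

theorem re_pos_of_mem_diskDelta {ζ : ℂ} (hζ : ζ ∈ diskDelta) : 0 < ζ.re := by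
  rw [diskDelta, Metric.mem_ball, dist_eq_norm] at hζ
  have h1 := abs_lt.1 ((Complex.abs_re_le_norm (ζ - 1)).trans_lt hζ)
  rw [Complex.sub_re, Complex.one_re] at h1
  linarith [h1.1]

theorem ne_zero_of_mem_diskDelta {ζ : ℂ} (hζ : ζ ∈ diskDelta) : ζ ≠ 0 := fun h => by
  have := re_pos_of_mem_diskDelta hζ
  simp [h] at this

theorem norm_lt_two_of_mem_diskDelta {ζ : ℂ} (hζ : ζ ∈ diskDelta) : ‖ζ‖ < 2 := by
  rw [diskDelta, Metric.mem_ball, dist_eq_norm] at hζ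
  have := norm_add_le (ζ - 1) 1
  rw [sub_add_cancel, norm_one] at this
  linarith

theorem measurableSet_diskDelta : MeasurableSet diskDelta := measurableSet_ball

instance isFiniteMeasure_restrict_diskDelta : IsFiniteMeasure (volume.restrict diskDelta) :=
  ⟨by rw [Measure.restrict_apply_univ]; exact measure_ball_lt_top⟩

/-- On the disc `|arg ζ| ≤ π/2` and `‖ζ‖ < 2`. The singularity at `0` is isolated in a factor that
is the same for all `z` with `Re z ≥ δ`. -/
theorem norm_cpow_sub_one_le {ζ z : ℂ} (hζ : ζ ∈ diskDelta) {δ : ℝ} (hδ : 0 < δ)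
    (hz : δ ≤ z.re) :
    ‖ζ ^ (z - 1)‖ ≤ 2 ^ z.re * Real.exp (Real.pi / 2 * |z.im|) * ‖ζ‖ ^ (δ - 1) := by
  have h0 := ne_zero_of_mem_diskDelta hζ
  have hpos := norm_pos_iff.2 h0
  have harg : |ζ.arg| ≤ Real.pi / 2 :=
    (Complex.abs_arg_lt_pi_div_two_iff.2 (Or.inl (re_pos_of_mem_diskDelta hζ))).le
  rw [Complex.norm_cpow_of_ne_zero h0, div_eq_mul_inv, ← Real.exp_neg]
  have h1 : ‖ζ‖ ^ (z - 1).re ≤ 2 ^ z.re * ‖ζ‖ ^ (δ - 1) := by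
    have e : (z - 1).re = (z.re - δ) + (δ - 1) := by simp
    rw [e, Real.rpow_add hpos]
    refine mul_le_mul_of_nonneg_right ?_ (by positivity)
    calc ‖ζ‖ ^ (z.re - δ) ≤ 2 ^ (z.re - δ) :=
          Real.rpow_le_rpow hpos.le (norm_lt_two_of_mem_diskDelta hζ).le (by linarith)
      _ ≤ 2 ^ z.re := Real.rpow_le_rpow_of_exponent_le one_le_two (by linarith)
  have h2 : -(ζ.arg * (z - 1).im) ≤ Real.pi / 2 * |z.im| := by
    refine (neg_le_abs _).trans ?_
    rw [abs_mul]
    simp only [Complex.sub_im, Complex.one_im, sub_zero]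
    gcongr
  calc ‖ζ‖ ^ (z - 1).re * Real.exp (-(ζ.arg * (z - 1).im))
      ≤ (2 ^ z.re * ‖ζ‖ ^ (δ - 1)) * Real.exp (Real.pi / 2 * |z.im|) := by gcongr
    _ = _ := by ring

/-- The exponent `2 (δ - 1)` exceeds `-2`, so the square is integrable near `0` in the plane. -/
theorem memLp_norm_rpow {δ : ℝ} (hδ : 0 < δ) :
    MemLp (fun ζ : ℂ => ‖ζ‖ ^ (δ - 1)) 2 (volume.restrict diskDelta) := by
  have hmeas : Measurable fun ζ : ℂ => ‖ζ‖ ^ (δ - 1) := measurable_norm.pow_const _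
  rw [memLp_two_iff_integrable_sq hmeas.aestronglyMeasurable]
  have h1 : IntegrableOn (fun ζ : ℂ => (‖ζ‖ ^ (δ - 1)) ^ 2) (Metric.ball 0 2) := by
    refine integrableOn_ball_of_norm_le_rpow (C := 1) (α := 2 - 2 * δ) (by simp) (by simp; linarith)
      (Eventually.of_forall fun _ => le_of_eq ?_) (hmeas.pow_const 2).aestronglyMeasurable
    rw [Real.norm_of_nonneg (by positivity), one_mul, ← Real.rpow_natCast,
      ← Real.rpow_mul (norm_nonneg _)]
    congr 1
    push_cast; ring
  exact h1.mono_set fun _ hζ => by simpa using norm_lt_two_of_mem_diskDelta hζ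

theorem differentiableOn_cpow_sub_one (z : ℂ) :
    DifferentiableOn ℂ (fun ζ : ℂ => ζ ^ (z - 1)) diskDelta := fun _ hζ =>
  ((differentiableAt_id.cpow (differentiableAt_const _)
    (Or.inl (re_pos_of_mem_diskDelta hζ)))).differentiableWithinAt

theorem _root_.DifferentiableOn.aestronglyMeasurable_diskDelta {f : ℂ → ℂ}
    (hf : DifferentiableOn ℂ f diskDelta) :
    AEStronglyMeasurable f (volume.restrict diskDelta) :=
  hf.continuousOn.aestronglyMeasurable measurableSet_diskDelta

theorem memBergman_cpow_sub_one {z : ℂ} (hz : 0 < z.re) :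
    MemBergman fun ζ : ℂ => ζ ^ (z - 1) := by
  have hd := differentiableOn_cpow_sub_one z
  refine ⟨hd, ((memLp_norm_rpow hz).const_mul
    (2 ^ z.re * Real.exp (Real.pi / 2 * |z.im|))).mono' hd.aestronglyMeasurable_diskDelta ?_⟩
  filter_upwards [ae_restrict_mem measurableSet_diskDelta] with ζ hζ
  exact norm_cpow_sub_one_le hζ hz le_rfl

/-- The pairing of `h` with the powers, a holomorphic function of the exponent. -/
def powerPairing (h : ℂ → ℂ) (z : ℂ) : ℂ :=
  ∫ ζ in diskDelta, (starRingEnd ℂ) (h ζ) * ζ ^ (z - 1)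

theorem norm_powerPairing_le {h : ℂ → ℂ} (hh : MemLp h 2 (volume.restrict diskDelta)) {z : ℂ}
    {δ : ℝ} (hδ : 0 < δ) (hz : δ ≤ z.re) :
    ‖powerPairing h z‖ ≤ 2 ^ z.re * Real.exp (Real.pi / 2 * |z.im|) *
      ∫ ζ in diskDelta, ‖h ζ‖ * ‖ζ‖ ^ (δ - 1) := by
  rw [← integral_const_mul]
  refine norm_integral_le_of_norm_le ((hh.norm.integrable_mul (memLp_norm_rpow hδ)).const_mul _) ?_
  filter_upwards [ae_restrict_mem measurableSet_diskDelta] with ζ hζ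
  rw [norm_mul, RCLike.norm_conj]
  calc ‖h ζ‖ * ‖ζ ^ (z - 1)‖ ≤ ‖h ζ‖ *
        (2 ^ z.re * Real.exp (Real.pi / 2 * |z.im|) * ‖ζ‖ ^ (δ - 1)) := by
        gcongr; exact norm_cpow_sub_one_le hζ hδ hz
    _ = _ := by ring

theorem differentiableOn_powerPairing {h : ℂ → ℂ}
    (hh : MemLp h 2 (volume.restrict diskDelta)) :
    DifferentiableOn ℂ (powerPairing h) rightHalfPlane := by
  refine differentiableOn_integral_of_dominated ?_ (fun z _ => ?_) fun z₀ hz₀ => ?_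
  · filter_upwards [ae_restrict_mem measurableSet_diskDelta] with ζ hζ
    refine DifferentiableOn.const_mul (fun z _ => ?_) _
    exact (DifferentiableAt.const_cpow (by fun_prop)
      (Or.inl (ne_zero_of_mem_diskDelta hζ))).differentiableWithinAt
  · exact (Complex.continuous_conj.comp_aestronglyMeasurable hh.1).mul
      (differentiableOn_cpow_sub_one z).aestronglyMeasurable_diskDelta
  · have hz₀' : 0 < z₀.re := hz₀
    set δ := z₀.re / 2 with hδ
    have hδ0 : 0 < δ := by positivity
    have hball : ∀ z ∈ Metric.ball z₀ δ, δ ≤ z.re ∧ z.re ≤ 3 * δ ∧ |z.im| ≤ |z₀.im| + δ := by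
      intro z hz
      rw [Metric.mem_ball, dist_eq_norm] at hz
      have h1 := abs_lt.1 ((Complex.abs_re_le_norm (z - z₀)).trans_lt hz)
      have h2 := (Complex.abs_im_le_norm (z - z₀)).trans_lt hz
      rw [Complex.sub_re] at h1
      rw [Complex.sub_im] at h2
      refine ⟨by linarith [h1.1], by linarith [h1.2], ?_⟩
      have := abs_sub_abs_le_abs_sub z.im z₀.im
      linarith
    refine ⟨δ, hδ0, fun z hz => hδ0.trans_le (hball z hz).1, fun ζ =>
      2 ^ (3 * δ) * Real.exp (Real.pi / 2 * (|z₀.im| + δ)) * (‖h ζ‖ * ‖ζ‖ ^ (δ - 1)),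
      (hh.norm.integrable_mul (memLp_norm_rpow hδ0)).const_mul _, ?_⟩
    filter_upwards [ae_restrict_mem measurableSet_diskDelta] with ζ hζ z hz
    obtain ⟨h1, h2, h3⟩ := hball z hz
    rw [norm_mul, RCLike.norm_conj]
    calc ‖h ζ‖ * ‖ζ ^ (z - 1)‖ ≤ ‖h ζ‖ *
          (2 ^ z.re * Real.exp (Real.pi / 2 * |z.im|) * ‖ζ‖ ^ (δ - 1)) := by
          gcongr; exact norm_cpow_sub_one_le hζ hδ0 h1
      _ ≤ ‖h ζ‖ * (2 ^ (3 * δ) * Real.exp (Real.pi / 2 * (|z₀.im| + δ)) * ‖ζ‖ ^ (δ - 1)) := by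
          gcongr
          exact one_le_two
      _ = _ := by ring

/-- Shows that the decay of `exp (w log w)` in vertical directions compensates `exp (π/2 |Im w|)` up
to `exp (Re w)`. -/
theorem pi_div_two_mul_abs_im_le {w : ℂ} (hw : 0 < w.re) :
    Real.pi / 2 * |w.im| ≤ w.im * w.arg + w.re := by
  have hw0 : w ≠ 0 := fun h => by simp [h] at hw
  have harg := Complex.abs_arg_lt_pi_div_two_iff.2 (Or.inl hw)
  have him : w.im * w.arg = |w.im| * |w.arg| := by
    rw [← abs_mul, abs_of_nonneg]
    rcases le_or_gt 0 w.im with h | h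
    · exact mul_nonneg h (Complex.arg_nonneg_iff.2 h)
    · exact mul_nonneg_of_nonpos_of_nonpos h.le (Complex.arg_neg_iff.2 h).le
  have hsin : |w.im| = ‖w‖ * Real.sin |w.arg| := by
    rw [← Complex.norm_mul_sin_arg w, abs_mul, abs_norm]
    congr 1
    rw [Real.abs_sin_eq_sin_abs_of_abs_le_pi (Complex.abs_arg_le_pi w)]
  have hcos : w.re = ‖w‖ * Real.cos |w.arg| := by
    rw [Real.cos_abs, Complex.norm_mul_cos_arg]
  rw [him, hsin]
  conv_rhs => rw [hcos]
  set φ := |w.arg|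
  have hψ : 0 < Real.pi / 2 - φ := by linarith
  -- With `ψ = π/2 - φ` this is `ψ ≤ tan ψ`.
  have key : (Real.pi / 2 - φ) * Real.sin φ ≤ Real.cos φ := by
    rw [← Real.cos_pi_div_two_sub φ, ← Real.sin_pi_div_two_sub φ]
    rcases (show Real.pi / 2 - φ ≤ Real.pi / 2 by linarith [abs_nonneg w.arg]).eq_or_lt with h | h
    · rw [h]; simp
    · have hc : 0 < Real.cos (Real.pi / 2 - φ) := Real.cos_pos_of_mem_Ioo ⟨by linarith, h⟩
      have := Real.lt_tan hψ h
      rw [Real.tan_eq_sin_div_cos, lt_div_iff₀ hc] at this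
      exact this.le
  nlinarith [mul_le_mul_of_nonneg_left key (norm_nonneg w)]

/-- The pairing with the powers satisfies the growth condition after multiplication by a
nonvanishing function. -/
theorem hasGrowth_powerPairing_mul_exp {h : ℂ → ℂ}
    (hh : MemLp h 2 (volume.restrict diskDelta)) :
    HasGrowth fun z => powerPairing h z * Complex.exp ((z + 1) * Complex.log (z + 1)) := by
  intro δ hδ
  set Cδ := ∫ ζ in diskDelta, ‖h ζ‖ * ‖ζ‖ ^ (δ - 1) with hC
  have hC0 : 0 ≤ Cδ := integral_nonneg fun ζ => by positivity
  -- `log 2` comes from `2 ^ Re z`, `1` from the argument estimate `harg`, and `Cδ` from the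
  -- prefactor via `hCexp`.
  refine ⟨Real.log 2 + 1 + Cδ, fun z hz => ?_⟩
  have hre : 0 < z.re := hδ.trans_le hz
  have h1 := norm_powerPairing_le hh hδ hz
  have harg := pi_div_two_mul_abs_im_le (w := z + 1) (by simp; linarith)
  simp only [Complex.add_re, Complex.add_im, Complex.one_re, Complex.one_im, add_zero] at harg
  have hlog : Real.log ‖z + 1‖ ≤ Real.log (1 + ‖z‖) := by
    refine Real.log_le_log (norm_pos_iff.2 fun h => ?_) ?_
    · have := congrArg Complex.re h
      simp at this; linarith
    · have := norm_add_le z 1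
      rw [norm_one] at this
      linarith
  have hlog2 : 0 ≤ Real.log 2 := Real.log_nonneg one_le_two
  have hCexp : Cδ ≤ Real.exp ((1 + z.re) * Cδ) := by
    have := Real.add_one_le_exp ((1 + z.re) * Cδ)
    nlinarith [mul_nonneg hre.le hC0]
  rw [norm_mul, Complex.norm_exp]
  have hexp : ((z + 1) * Complex.log (z + 1)).re =
      (z.re + 1) * Real.log ‖z + 1‖ - z.im * (z + 1).arg := by
    simp [Complex.mul_re, Complex.log_re, Complex.log_im]
  rw [hexp]
  calc ‖powerPairing h z‖ * Real.exp ((z.re + 1) * Real.log ‖z + 1‖ - z.im * (z + 1).arg)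
      ≤ (2 ^ z.re * Real.exp (Real.pi / 2 * |z.im|) * Real.exp ((1 + z.re) * Cδ)) *
        Real.exp ((z.re + 1) * Real.log ‖z + 1‖ - z.im * (z + 1).arg) := by
        gcongr
        exact h1.trans (by gcongr)
    _ = Real.exp (Real.log 2 * z.re + Real.pi / 2 * |z.im| + (1 + z.re) * Cδ +
        ((z.re + 1) * Real.log ‖z + 1‖ - z.im * (z + 1).arg)) := by
        rw [Real.rpow_def_of_pos two_pos, ← Real.exp_add, ← Real.exp_add, ← Real.exp_add]
    _ ≤ _ := by
        rw [Real.exp_le_exp]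
        nlinarith [mul_le_mul_of_nonneg_left hlog (show 0 ≤ z.re + 1 by linarith)]

theorem powerPairing_eq_zero {h : ℂ → ℂ} (hh : MemLp h 2 (volume.restrict diskDelta))
    {Z : Set ℂ} {ε₀ : ℝ} (hε₀ : 0 < ε₀) (hZre : ∀ w ∈ Z, ε₀ ≤ w.re)
    (hviol : ¬ CarlemanCondition Z) (hZ : ∀ w ∈ Z, powerPairing h w = 0) {z : ℂ}
    (hz : 0 < z.re) : powerPairing h z = 0 := by
  have hd : DifferentiableOn ℂ
      (fun z => powerPairing h z * Complex.exp ((z + 1) * Complex.log (z + 1))) rightHalfPlane := by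
    refine (differentiableOn_powerPairing hh).mul fun z hz => ?_
    have hz' : 0 < z.re := hz
    refine DifferentiableAt.differentiableWithinAt ?_
    refine DifferentiableAt.cexp (DifferentiableAt.mul (by fun_prop)
      (DifferentiableAt.clog (by fun_prop) (Or.inl ?_)))
    simp; linarith
  have := eq_zero_of_hasGrowth hd (hasGrowth_powerPairing_mul_exp hh) hε₀ hZre
    (fun w hw => by rw [hZ w hw, zero_mul]) hviol z hz
  exact (mul_eq_zero.1 this).resolve_right (Complex.exp_ne_zero _)

/-! ### From orthogonality to monomials to orthogonality to the Bergman space. -/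

theorem _root_.MeasureTheory.MemLp.integrable_conj_mul {α : Type*} [MeasurableSpace α]
    {μ : Measure α} {h g : α → ℂ} (hh : MemLp h 2 μ) (hg : MemLp g 2 μ) :
    Integrable (fun ζ => (starRingEnd ℂ) (h ζ) * g ζ) μ :=
  MemLp.integrable_mul (p := 2) (q := 2) hh.star hg

theorem _root_.Continuous.memLp_diskDelta {g : ℂ → ℂ} (hg : Continuous g) :
    MemLp g 2 (volume.restrict diskDelta) := by
  obtain ⟨C, hC⟩ := (isCompact_closedBall (1 : ℂ) 1).exists_bound_of_continuousOn hg.continuousOn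
  refine MemLp.of_bound hg.aestronglyMeasurable C ?_
  filter_upwards [ae_restrict_mem measurableSet_diskDelta] with ζ hζ
  exact hC ζ (Metric.ball_subset_closedBall hζ)

theorem integral_conj_mul_polynomial_eq_zero {h : ℂ → ℂ}
    (hh : MemLp h 2 (volume.restrict diskDelta))
    (hpow : ∀ n : ℕ, ∫ ζ in diskDelta, (starRingEnd ℂ) (h ζ) * ζ ^ n = 0) (P : Polynomial ℂ) :
    ∫ ζ in diskDelta, (starRingEnd ℂ) (h ζ) * P.eval ζ = 0 := by
  have e : ∀ ζ, (starRingEnd ℂ) (h ζ) * P.eval ζ =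
      ∑ i ∈ Finset.range (P.natDegree + 1), P.coeff i * ((starRingEnd ℂ) (h ζ) * ζ ^ i) := by
    intro ζ
    rw [Polynomial.eval_eq_sum_range, Finset.mul_sum]
    exact Finset.sum_congr rfl fun i _ => by ring
  simp_rw [e]
  rw [integral_finsetSum _ fun i _ =>
    (hh.integrable_conj_mul (continuous_pow i).memLp_diskDelta).const_mul _]
  exact Finset.sum_eq_zero fun i _ => by rw [integral_const_mul, hpow, mul_zero]

theorem dilation_mem_closedBall {ζ : ℂ} (hζ : ζ ∈ diskDelta) {r : ℝ} (hr : 0 ≤ r) :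
    1 + r * (ζ - 1) ∈ Metric.closedBall (1 : ℂ) r := by
  rw [diskDelta, Metric.mem_ball, dist_eq_norm] at hζ
  rw [Metric.mem_closedBall, dist_eq_norm, add_sub_cancel_left, norm_mul, Complex.norm_real,
    Real.norm_of_nonneg hr]
  nlinarith

theorem memLp_dilation {f : ℂ → ℂ} (hf : DifferentiableOn ℂ f diskDelta) {r : ℝ} (hr0 : 0 ≤ r)
    (hr : r < 1) : MemLp (fun ζ : ℂ => f (1 + r * (ζ - 1))) 2 (volume.restrict diskDelta) := by
  have hsub : Metric.closedBall (1 : ℂ) r ⊆ diskDelta := Metric.closedBall_subset_ball hr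
  obtain ⟨C, hC⟩ := (isCompact_closedBall (1 : ℂ) r).exists_bound_of_continuousOn
    (hf.continuousOn.mono hsub)
  refine MemLp.of_bound (DifferentiableOn.aestronglyMeasurable_diskDelta
    (hf.comp (by fun_prop) fun ζ hζ => hsub (dilation_mem_closedBall hζ hr0))) C ?_
  filter_upwards [ae_restrict_mem measurableSet_diskDelta] with ζ hζ
  exact hC _ (dilation_mem_closedBall hζ hr0)

/-- The dilated function is a uniform limit on the disc of Taylor polynomials centred at `1`. -/
theorem integral_conj_mul_dilation_eq_zero {h f : ℂ → ℂ}
    (hh : MemLp h 2 (volume.restrict diskDelta))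
    (hpow : ∀ n : ℕ, ∫ ζ in diskDelta, (starRingEnd ℂ) (h ζ) * ζ ^ n = 0)
    (hf : DifferentiableOn ℂ f diskDelta) {r : ℝ} (hr0 : 0 < r) (hr : r < 1) :
    ∫ ζ in diskDelta, (starRingEnd ℂ) (h ζ) * f (1 + r * (ζ - 1)) = 0 := by
  -- An intermediate radius `r < r₁ < 1`: the Taylor series of `f` at `1` converges uniformly on the
  -- ball of radius `r`.
  set r₁ : NNReal := ⟨(1 + r) / 2, by linarith⟩ with hr₁
  have hr₁' : (r₁ : ℝ) = (1 + r) / 2 := rfl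
  set r₂ : NNReal := ⟨r, hr0.le⟩ with hr₂
  have hps := (hf.mono (Metric.closedBall_subset_ball
    (by rw [hr₁']; linarith) : Metric.closedBall (1 : ℂ) r₁ ⊆ diskDelta)).hasFPowerSeriesOnBall
    (by rw [← NNReal.coe_pos, hr₁']; linarith)
  set p := cauchyPowerSeries f 1 r₁
  have hunif := hps.tendstoUniformlyOn (r' := r₂)
    (by rw [ENNReal.coe_lt_coe, ← NNReal.coe_lt_coe, hr₁']; change r < _; linarith)
  rw [Metric.tendstoUniformlyOn_iff] at hunif
  set B := ∫ ζ in diskDelta, ‖h ζ‖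
  have hhint : Integrable h (volume.restrict diskDelta) := hh.integrable one_le_two
  have hB : 0 ≤ B := integral_nonneg fun _ => norm_nonneg _
  have hbound : ∀ ε : ℝ, 0 < ε →
      ‖∫ ζ in diskDelta, (starRingEnd ℂ) (h ζ) * f (1 + r * (ζ - 1))‖ ≤ ε * B := by
    intro ε hε
    obtain ⟨n, hn⟩ := (hunif ε hε).exists
    set P : Polynomial ℂ := ∑ k ∈ Finset.range n, Polynomial.C (p.coeff k) *
      (Polynomial.C (r : ℂ) * (Polynomial.X - Polynomial.C 1)) ^ k with hP
    have hPeval : ∀ ζ, P.eval ζ = p.partialSum n (r * (ζ - 1)) := by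
      intro ζ
      rw [hP, Polynomial.eval_finsetSum, FormalMultilinearSeries.partialSum]
      refine Finset.sum_congr rfl fun k _ => ?_
      rw [p.apply_eq_pow_smul_coeff]
      simp [mul_comm]
    have hP0 := integral_conj_mul_polynomial_eq_zero hh hpow P
    rw [← sub_zero (∫ ζ in diskDelta, _), ← hP0, ← integral_sub
      (hh.integrable_conj_mul (memLp_dilation hf hr0.le hr))
      (hh.integrable_conj_mul P.continuous.memLp_diskDelta), ← integral_const_mul]
    refine norm_integral_le_of_norm_le (hhint.norm.const_mul ε) ?_
    filter_upwards [ae_restrict_mem measurableSet_diskDelta] with ζ hζ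
    have hmem : (r : ℂ) * (ζ - 1) ∈ Metric.ball (0 : ℂ) r₂ := by
      rw [diskDelta, Metric.mem_ball, dist_eq_norm] at hζ
      rw [mem_ball_zero_iff, norm_mul, Complex.norm_real, Real.norm_of_nonneg hr0.le]
      change r * ‖ζ - 1‖ < r
      nlinarith
    have h1 := (hn _ hmem).le
    rw [dist_eq_norm, ← hPeval] at h1
    rw [← mul_sub, norm_mul, RCLike.norm_conj, mul_comm]
    gcongr
  have hlim : Tendsto (fun ε : ℝ => ε * B) (𝓝[>] 0) (𝓝 0) := by
    have : Tendsto (fun ε : ℝ => ε * B) (𝓝 0) (𝓝 (0 * B)) := tendsto_id.mul_const B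
    rw [zero_mul] at this
    exact this.mono_left nhdsWithin_le_nhds
  exact norm_le_zero_iff.1 (ge_of_tendsto hlim (eventually_nhdsWithin_of_forall fun ε hε => hbound ε hε))

/-- Change of variables; the Jacobian factor `r⁻²` is at most `4`. -/
theorem integral_norm_sq_dilation_le {f : ℂ → ℂ} (hf : MemBergman f) {r : ℝ} (hr0 : 1 / 2 ≤ r)
    (hr : r < 1) :
    ∫ ζ in diskDelta, ‖f (1 + r * (ζ - 1))‖ ^ 2 ≤ 4 * ∫ ζ in diskDelta, ‖f ζ‖ ^ 2 := by
  have hrpos : 0 < r := by linarith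
  set φ : ℂ → ℝ := (Metric.ball (1 : ℂ) r).indicator fun ζ => ‖f ζ‖ ^ 2 with hφ
  have hint : IntegrableOn (fun ζ => ‖f ζ‖ ^ 2) diskDelta := hf.2.integrable_norm_pow two_ne_zero
  have h1 : ∫ ζ in diskDelta, ‖f (1 + r * (ζ - 1))‖ ^ 2 = ∫ ζ : ℂ, φ (r • (ζ + -1) + 1) := by
    rw [← integral_indicator measurableSet_diskDelta]
    refine integral_congr_ae (Eventually.of_forall fun ζ => ?_)
    have hiff : r • (ζ + -1) + 1 ∈ Metric.ball (1 : ℂ) r ↔ ζ ∈ diskDelta := by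
      rw [diskDelta, Metric.mem_ball, Metric.mem_ball, dist_eq_norm, dist_eq_norm,
        add_sub_cancel_right, norm_smul, Real.norm_of_nonneg hrpos.le, ← sub_eq_add_neg]
      exact mul_lt_iff_lt_one_right hrpos
    by_cases hζ : ζ ∈ diskDelta
    · simp only
      rw [Set.indicator_of_mem hζ, hφ, Set.indicator_of_mem (hiff.2 hζ)]
      congr 3
      rw [Complex.real_smul]; ring
    · simp only
      rw [Set.indicator_of_notMem hζ, hφ, Set.indicator_of_notMem fun h => hζ (hiff.1 h)]
  rw [h1, integral_add_right_eq_self (fun ζ : ℂ => φ (r • ζ + 1)) (-1),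
    Measure.integral_comp_smul volume (fun ζ : ℂ => φ (ζ + 1)) r,
    integral_add_right_eq_self φ 1, hφ, integral_indicator measurableSet_ball, smul_eq_mul]
  have h2 : |(r ^ Module.finrank ℝ ℂ)⁻¹| ≤ 4 := by
    rw [Complex.finrank_real_complex, abs_of_pos (by positivity)]
    refine inv_le_of_inv_le₀ (by norm_num) ?_
    nlinarith
  refine mul_le_mul h2 (setIntegral_mono_set hint (Eventually.of_forall fun ζ => by positivity)
    (Metric.ball_subset_ball hr.le).eventuallyLE) (integral_nonneg fun ζ => by positivity)
    (by norm_num)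

/-- Away from the boundary circle `f` is bounded, so dominated convergence applies. -/
theorem tendsto_setIntegral_norm_mul_sub_dilation {h f : ℂ → ℂ}
    (hh : MemLp h 2 (volume.restrict diskDelta)) (hf : DifferentiableOn ℂ f diskDelta)
    {ρ : ℝ} (hρ : ρ < 1) {r : ℕ → ℝ} (hr0 : ∀ n, 0 ≤ r n) (hr1 : ∀ n, r n < 1)
    (hr : Tendsto r atTop (𝓝 1)) :
    Tendsto (fun n => ∫ ζ in diskDelta ∩ Metric.ball 1 ρ,
      ‖h ζ‖ * ‖f ζ - f (1 + r n * (ζ - 1))‖) atTop (𝓝 0) := by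
  have hsub : Metric.closedBall (1 : ℂ) ρ ⊆ diskDelta := Metric.closedBall_subset_ball hρ
  have hms : MeasurableSet (diskDelta ∩ Metric.ball 1 ρ) :=
    measurableSet_diskDelta.inter measurableSet_ball
  obtain ⟨C, hC⟩ := (isCompact_closedBall (1 : ℂ) ρ).exists_bound_of_continuousOn
    (hf.continuousOn.mono hsub)
  have hle : volume.restrict (diskDelta ∩ Metric.ball 1 ρ) ≤ volume.restrict diskDelta :=
    Measure.restrict_mono_set _ Set.inter_subset_left
  have hhint : Integrable h (volume.restrict diskDelta) := hh.integrable one_le_two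
  have hzero : (0 : ℝ) = ∫ ζ in diskDelta ∩ Metric.ball (1 : ℂ) ρ, (0 : ℝ) := by simp
  rw [hzero]
  refine tendsto_integral_of_dominated_convergence (fun ζ => ‖h ζ‖ * (C + C)) (fun n => ?_)
    ((hhint.norm.mono_measure hle).mul_const _) (fun n => ?_) ?_
  · exact (hh.1.norm.mul (hf.aestronglyMeasurable_diskDelta.sub
      (memLp_dilation hf (hr0 n) (hr1 n)).1).norm).mono_measure hle
  · filter_upwards [ae_restrict_mem hms] with ζ hζ
    rw [norm_mul, norm_norm, norm_norm]
    refine mul_le_mul_of_nonneg_left ((norm_sub_le _ _).trans (add_le_add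
      (hC ζ (Metric.ball_subset_closedBall hζ.2)) (hC _ ?_))) (norm_nonneg _)
    have h1 := hζ.2
    rw [Metric.mem_ball, dist_eq_norm] at h1
    rw [Metric.mem_closedBall, dist_eq_norm, add_sub_cancel_left, norm_mul, Complex.norm_real,
      Real.norm_of_nonneg (hr0 n)]
    nlinarith [norm_nonneg (ζ - 1), hr0 n, hr1 n]
  · filter_upwards [ae_restrict_mem hms] with ζ hζ
    have hcont : ContinuousAt f ζ :=
      (hf.continuousOn ζ hζ.1).continuousAt (Metric.isOpen_ball.mem_nhds hζ.1)
    have h1 : Tendsto (fun n => (1 : ℂ) + r n * (ζ - 1)) atTop (𝓝 ζ) := by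
      have h2 : Tendsto (fun n => (1 : ℂ) + r n * (ζ - 1)) atTop
          (𝓝 (1 + (1 : ℝ) * (ζ - 1))) :=
        (((Complex.continuous_ofReal.tendsto 1).comp hr).mul_const _).const_add _
      simpa using h2
    have h3 := ((hcont.tendsto.comp h1).const_sub (f ζ)).norm.const_mul ‖h ζ‖
    simpa using h3

/-- Weighted arithmetic-geometric inequality with a free parameter `l`, meant for a thin rim `A`.
The constant is `5 = 1 + 4`, with `4` from the dilation bound. -/
theorem setIntegral_norm_mul_sub_dilation_le {h f : ℂ → ℂ}
    (hh : MemLp h 2 (volume.restrict diskDelta)) (hf : MemBergman f) {A : Set ℂ}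
    (hA : A ⊆ diskDelta) {r l : ℝ} (hr0 : 1 / 2 ≤ r) (hr1 : r < 1) (hl : 0 < l) :
    ∫ ζ in A, ‖h ζ‖ * ‖f ζ - f (1 + r * (ζ - 1))‖ ≤
      l / 2 * (∫ ζ in A, ‖h ζ‖ ^ 2) + 5 / l * ∫ ζ in diskDelta, ‖f ζ‖ ^ 2 := by
  have hd := memLp_dilation hf.1 (by linarith) hr1
  have i1 : IntegrableOn (fun ζ => ‖h ζ‖ ^ 2) diskDelta := hh.integrable_norm_pow two_ne_zero
  have i2 : IntegrableOn (fun ζ => ‖f ζ‖ ^ 2) diskDelta := hf.2.integrable_norm_pow two_ne_zero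
  have i3 : IntegrableOn (fun ζ : ℂ => ‖f (1 + r * (ζ - 1))‖ ^ 2) diskDelta :=
    hd.integrable_norm_pow two_ne_zero
  have i4 : IntegrableOn (fun ζ : ℂ => ‖h ζ‖ * ‖f ζ - f (1 + r * (ζ - 1))‖) diskDelta :=
    MemLp.integrable_mul (p := 2) (q := 2) hh.norm (hf.2.sub hd).norm
  have i23 : IntegrableOn (fun ζ : ℂ => 1 / l * (‖f ζ‖ ^ 2 + ‖f (1 + r * (ζ - 1))‖ ^ 2))
      diskDelta := (i2.add i3).const_mul _
  calc ∫ ζ in A, ‖h ζ‖ * ‖f ζ - f (1 + r * (ζ - 1))‖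
      ≤ ∫ ζ in A, (l / 2 * ‖h ζ‖ ^ 2 + 1 / l * (‖f ζ‖ ^ 2 + ‖f (1 + r * (ζ - 1))‖ ^ 2)) := by
        refine integral_mono (i4.mono_set hA) (((i1.mono_set hA).const_mul _).add
          (i23.mono_set hA)) fun ζ => ?_
        simp only
        set x := ‖h ζ‖
        set y := ‖f ζ‖
        set w := ‖f (1 + r * (ζ - 1))‖
        have h1 : ‖f ζ - f (1 + r * (ζ - 1))‖ ≤ y + w := norm_sub_le _ _
        have h2 : x * (y + w) ≤ l / 2 * x ^ 2 + 1 / l * (y ^ 2 + w ^ 2) := by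
          rw [one_div, ← sub_nonneg]
          have : l / 2 * x ^ 2 + l⁻¹ * (y ^ 2 + w ^ 2) - x * (y + w) =
              ((l * x - (y + w)) ^ 2 + (y - w) ^ 2) / (2 * l) := by
            field_simp; ring
          rw [this]; positivity
        exact (mul_le_mul_of_nonneg_left h1 (norm_nonneg _)).trans h2
    _ = l / 2 * (∫ ζ in A, ‖h ζ‖ ^ 2) +
          ∫ ζ in A, 1 / l * (‖f ζ‖ ^ 2 + ‖f (1 + r * (ζ - 1))‖ ^ 2) := by
        rw [integral_add ((i1.mono_set hA).const_mul _) (i23.mono_set hA), integral_const_mul]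
    _ ≤ l / 2 * (∫ ζ in A, ‖h ζ‖ ^ 2) +
          ∫ ζ in diskDelta, 1 / l * (‖f ζ‖ ^ 2 + ‖f (1 + r * (ζ - 1))‖ ^ 2) := by
        exact add_le_add le_rfl (setIntegral_mono_set i23
          (Eventually.of_forall fun ζ => by positivity) hA.eventuallyLE)
    _ ≤ _ := by
        rw [integral_const_mul, integral_add i2 i3]
        have := integral_norm_sq_dilation_le hf hr0 hr1
        rw [show 5 / l * ∫ ζ in diskDelta, ‖f ζ‖ ^ 2 = 1 / l * (5 * ∫ ζ in diskDelta, ‖f ζ‖ ^ 2)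
          by ring]
        gcongr
        linarith

/-- A square integrable function orthogonal to the monomials is orthogonal to the Bergman
space. -/
theorem integral_conj_mul_eq_zero_of_memBergman {h f : ℂ → ℂ}
    (hh : MemLp h 2 (volume.restrict diskDelta))
    (hpow : ∀ n : ℕ, ∫ ζ in diskDelta, (starRingEnd ℂ) (h ζ) * ζ ^ n = 0) (hf : MemBergman f) :
    ∫ ζ in diskDelta, (starRingEnd ℂ) (h ζ) * f ζ = 0 := by
  set a := ‖∫ ζ in diskDelta, (starRingEnd ℂ) (h ζ) * f ζ‖ with ha
  set B := ∫ ζ in diskDelta, ‖f ζ‖ ^ 2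
  set u : ℕ → ℝ := fun n => 1 - 1 / ((n : ℝ) + 1) with hu
  have hutend : Tendsto u atTop (𝓝 1) := by
    have := (tendsto_one_div_add_atTop_nhds_zero_nat (𝕜 := ℝ)).const_sub 1
    rwa [sub_zero] at this
  have hu1 : ∀ n, u n < 1 := fun n => by
    have : (0 : ℝ) < 1 / ((n : ℝ) + 1) := by positivity
    simp only [hu]; linarith
  have hu0 : ∀ n, 1 / 2 ≤ u (n + 1) := fun n => by
    have : 1 / (((n + 1 : ℕ) : ℝ) + 1) ≤ 1 / 2 :=
      one_div_le_one_div_of_le two_pos (by push_cast; linarith [n.cast_nonneg (α := ℝ)])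
    simp only [hu]; linarith
  have humono : Monotone u := fun m n hmn => by
    simp only [hu]
    gcongr
  -- Three limits in order: the dilation tends to the identity with the rim fixed, then the rim
  -- shrinks to the empty set, then `l → ∞`. The shift to `u (n + 1)` ensures a dilation ratio of at
  -- least `1/2`.
  have step1 : ∀ l : ℝ, 0 < l → ∀ m : ℕ,
      a ≤ l / 2 * (∫ ζ in diskDelta \ Metric.ball 1 (u m), ‖h ζ‖ ^ 2) + 5 / l * B := by
    intro l hl m
    have htend := (tendsto_setIntegral_norm_mul_sub_dilation hh hf.1 (hu1 m)
      (r := fun n => u (n + 1)) (fun n => by linarith [hu0 n]) (fun n => hu1 _)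
      (hutend.comp (tendsto_add_atTop_nat 1))).add_const
      (l / 2 * (∫ ζ in diskDelta \ Metric.ball 1 (u m), ‖h ζ‖ ^ 2) + 5 / l * B)
    rw [zero_add] at htend
    refine ge_of_tendsto' htend fun n => ?_
    set r := u (n + 1)
    have hr1 : r < 1 := hu1 _
    have hr0 : 1 / 2 ≤ r := hu0 n
    have hd := memLp_dilation hf.1 (by linarith) hr1
    have i4 : IntegrableOn (fun ζ : ℂ => ‖h ζ‖ * ‖f ζ - f (1 + r * (ζ - 1))‖) diskDelta :=
      MemLp.integrable_mul (p := 2) (q := 2) hh.norm (hf.2.sub hd).norm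
    have h0 := integral_conj_mul_dilation_eq_zero hh hpow hf.1 (by linarith) hr1
    calc a ≤ ∫ ζ in diskDelta, ‖h ζ‖ * ‖f ζ - f (1 + r * (ζ - 1))‖ := by
          rw [ha, ← sub_zero (∫ ζ in diskDelta, _), ← h0, ← integral_sub
            (hh.integrable_conj_mul hf.2) (hh.integrable_conj_mul hd)]
          refine norm_integral_le_of_norm_le i4 (Eventually.of_forall fun ζ => ?_)
          rw [← mul_sub, norm_mul, RCLike.norm_conj]
      _ = _ := (integral_inter_add_sdiff (t := Metric.ball 1 (u m)) measurableSet_ball i4).symm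
      _ ≤ _ := by
          gcongr
          exact setIntegral_norm_mul_sub_dilation_le hh hf Set.sdiff_subset hr0 hr1 hl
  have hinter : ⋂ m, diskDelta \ Metric.ball (1 : ℂ) (u m) = ∅ := by
    refine Set.eq_empty_of_forall_notMem fun ζ hζ => ?_
    rw [Set.mem_iInter] at hζ
    have h1 : dist ζ 1 < 1 := (hζ 0).1
    obtain ⟨m, hm⟩ := (hutend.eventually (lt_mem_nhds h1)).exists
    exact (hζ m).2 hm
  have step2 : ∀ l : ℝ, 0 < l → a ≤ 5 / l * B := by
    intro l hl
    have hhsq : IntegrableOn (fun ζ => ‖h ζ‖ ^ 2) diskDelta := hh.integrable_norm_pow two_ne_zero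
    have hlim := tendsto_setIntegral_of_antitone (μ := volume) (f := fun ζ : ℂ => ‖h ζ‖ ^ 2)
      (s := fun m => diskDelta \ Metric.ball (1 : ℂ) (u m))
      (fun m => measurableSet_diskDelta.diff measurableSet_ball)
      (fun m n hmn => Set.sdiff_subset_sdiff_right (Metric.ball_subset_ball (humono hmn)))
      ⟨0, hhsq.mono_set Set.sdiff_subset⟩
    rw [hinter, setIntegral_empty] at hlim
    have := (hlim.const_mul (l / 2)).add_const (5 / l * B)
    rw [mul_zero, zero_add] at this
    exact ge_of_tendsto' this (step1 l hl)
  have hlim : Tendsto (fun l : ℝ => 5 / l * B) atTop (𝓝 0) := by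
    have := (tendsto_const_nhds (x := (5 : ℝ)).div_atTop tendsto_id).mul_const B
    rwa [zero_mul] at this
  exact norm_le_zero_iff.1 (ge_of_tendsto hlim
    ((eventually_gt_atTop 0).mono fun l hl => step2 l hl))

/-! ### Duality in `L²` and conclusion. -/

theorem _root_.Submodule.exists_mem_span_ae_eq {α : Type*} [MeasurableSpace α] {μ : Measure α}
    {S : Set (α → ℂ)} {v : Lp ℂ 2 μ}
    (hv : v ∈ Submodule.span ℂ {w : Lp ℂ 2 μ | ∃ k ∈ S, w =ᵐ[μ] k}) :
    ∃ p ∈ Submodule.span ℂ S, v =ᵐ[μ] p := by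
  induction hv using Submodule.span_induction with
  | mem w hw =>
    obtain ⟨k, hk, hwk⟩ := hw
    exact ⟨k, Submodule.subset_span hk, hwk⟩
  | zero => exact ⟨0, Submodule.zero_mem _, Lp.coeFn_zero _ _ _⟩
  | add v w _ _ hv hw =>
    obtain ⟨p, hp, hvp⟩ := hv
    obtain ⟨q, hq, hwq⟩ := hw
    exact ⟨p + q, Submodule.add_mem _ hp hq, (Lp.coeFn_add v w).trans (hvp.add hwq)⟩
  | smul c v _ hv =>
    obtain ⟨p, hp, hvp⟩ := hv
    exact ⟨c • p, Submodule.smul_mem _ c hp, (Lp.coeFn_smul c v).trans (hvp.const_smul c)⟩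

/-- Completeness in the Bergman space by duality. -/
theorem isCompleteInBergman_of_orthogonal {S : Set (ℂ → ℂ)} (hS : ∀ p ∈ S, MemBergman p)
    (horth : ∀ h : ℂ → ℂ, MemLp h 2 (volume.restrict diskDelta) →
      (∀ p ∈ S, ∫ ζ in diskDelta, (starRingEnd ℂ) (h ζ) * p ζ = 0) →
      ∀ f, MemBergman f → ∫ ζ in diskDelta, (starRingEnd ℂ) (h ζ) * f ζ = 0) :
    IsCompleteInBergman S := by
  refine ⟨hS, fun f hf ε hε => ?_⟩
  set μ := volume.restrict diskDelta with hμ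
  set V : Submodule ℂ (Lp ℂ 2 μ) := Submodule.span ℂ {w : Lp ℂ 2 μ | ∃ k ∈ S, w =ᵐ[μ] k} with hV
  -- The double orthogonal is taken in all of `L²`, so the test function `h` need not be
  -- holomorphic.
  have hmem : hf.2.toLp f ∈ V.topologicalClosure := by
    rw [← Submodule.orthogonal_orthogonal_eq_closure, Submodule.mem_orthogonal]
    intro h hh
    rw [L2.inner_def]
    have hfh := horth h (Lp.memLp h) (fun p hp => ?_) f hf
    · rw [← hfh]
      refine integral_congr_ae ?_
      filter_upwards [hf.2.coeFn_toLp] with ζ hζ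
      rw [hζ, RCLike.inner_apply, mul_comm]
    · have h1 := (Submodule.mem_orthogonal' V h).1 hh ((hS p hp).2.toLp p)
        (Submodule.subset_span ⟨p, hp, (hS p hp).2.coeFn_toLp⟩)
      rw [L2.inner_def] at h1
      rw [← h1]
      refine integral_congr_ae ?_
      filter_upwards [(hS p hp).2.coeFn_toLp] with ζ hζ
      rw [hζ, RCLike.inner_apply, mul_comm]
  obtain ⟨v, hvV, hv⟩ := EMetric.mem_closure_iff.1 hmem ε hε
  obtain ⟨p, hp, hvp⟩ := Submodule.exists_mem_span_ae_eq hvV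
  refine ⟨p, hp, ?_⟩
  rw [Lp.edist_def] at hv
  refine lt_of_eq_of_lt (eLpNorm_congr_ae ?_) hv
  exact (hf.2.coeFn_toLp.sub hvp).symm

end MuntzSzasz

end

theorem mainTheorem7 (z : ℕ → ℂ) (ε₀ : ℝ) (hε₀ : 0 < ε₀) (hz : ∀ j, ε₀ ≤ (z j).re)
    (hviol : ¬ MuntzSzasz.CarlemanCondition (Set.range z)) :
    MuntzSzasz.IsUniquenessSet (Set.range z) ∧
      MuntzSzasz.IsCompleteInBergman
        (Set.range fun j : ℕ => fun ζ : ℂ => ζ ^ (z j - 1)) := by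
  have hZ : ∀ w ∈ Set.range z, ε₀ ≤ w.re := by
    rintro _ ⟨j, rfl⟩; exact hz j
  refine ⟨fun f hf hfZ => MuntzSzasz.eq_zero_of_hasGrowth hf.1 hf.hasGrowth hε₀ hZ hfZ hviol,
    MuntzSzasz.isCompleteInBergman_of_orthogonal ?_ fun h hh hp f hf =>
      MuntzSzasz.integral_conj_mul_eq_zero_of_memBergman hh (fun n => ?_) hf⟩
  · rintro _ ⟨j, rfl⟩
    exact MuntzSzasz.memBergman_cpow_sub_one (hε₀.trans_le (hz j))
  -- At `z = n + 1` the power `ζ ^ (z - 1)` is the monomial `ζ ^ n`.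
  · have h0 := MuntzSzasz.powerPairing_eq_zero hh hε₀ hZ hviol
      (by rintro _ ⟨j, rfl⟩; exact hp _ ⟨j, rfl⟩) (z := (n : ℂ) + 1) (by simp; positivity)
    simpa [MuntzSzasz.powerPairing] using h0
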